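/- Let $\theta\in\mathbb R$ and $\tau\ge 0$. The $q$-Meixner process with parameters $\theta,\tau$ and $q=0$ is the (time-inhomogeneous) Markov process on $\mathbb R$ whose transition probability $P_{s,t}(x,dy)$, $0\le s<t$, $x\in\mathbb R$, is the orthogonality probability measure of the monic polynomials $Q_n(y)=Q_n(y|x,s,t)$ given by $Q_0=1$, $Q_1(y)=y-x$ and $$yQ_n(y)=Q_{n+1}(y)+(\theta[n]_q+xq^n)Q_n(y)+(t-sq^{n-1}+\tau[n-1]_q)[n]_q\,Q_{n-1}(y),\qquad n\ge 1,$$ at $q=0$, where $[n]_q=\sum_{j=0}^{n-1}q^j$ and $0^0=1$; this measure exists and is unique. Put $(\mathsf P_{s,t}f)(x)=\int f(y)\,P_{s,t}(x,dy)$. For $t>0$ the weak left and right infinitesimal generators are the pointwise limits $$\mathbb A_t^-f=\lim_{h\to0^+}\tfrac1h(\mathsf P_{t-h,t}f-f),\qquad \mathbb A_t^+f=\lim_{h\to0^+}\tfrac1h(\mathsf P_{t,t+h}f-f),$$ whose domains $\mathcal D_t^\pm$ consist of the bounded continuous $f:\mathbb R\to\mathbb R$ for which the limit exists at every point and the sup-norms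 of the quotients are bounded in $h$ ($0<h\le t$ for $\mathbb A_t^-$, $h>0$ for $\mathbb A_t^+$). On polynomials $f$ the generators are the same limits, taken pointwise. Let $t>0$, and let $$w_{\theta,t+\tau}(dy)=\frac{\sqrt{4(t+\tau)-(y-\theta)^2}}{2\pi(t+\tau)}\,dy\quad\text{on } \bigl(\theta-2\sqrt{t+\tau},\,\theta+2\sqrt{t+\tau}\bigr)$$ be the semicircle law; it is a probability measure carried by this interval, with mean $\theta$ and variance $t+\tau$. If $f$ is a polynomial, then both limits exist at every $x\in\mathbb R$; if $f$ is a bounded continuous function with bounded continuous second derivative, then $f\in\mathcal D_t^-\cap\mathcal D_t^+$. In both cases, for every $x\in\mathbb R$, $$(\mathbb A_t^{-}f)(x)=(\mathbb A_t^{+}f)(x)=\int_{(\theta-2\sqrt{t+\tau},\,\theta+2\sqrt{t+\tau})}\left(\frac{\partial}{\partial x}\frac{f(y)-f(x)}{y-x}\right)w_{\theta,t+\tau}(dy),$$ where the integral converges absolutely. -/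

import Mathlib

open MeasureTheory Filter Topology Set
open scoped Polynomial BoundedContinuousFunction

noncomputable section

namespace QMeixner

/-- The `q`-integer `[n]_q = 1 + q + ... + q^(n-1)`. -/
def qInt (q : ℝ) (n : ℕ) : ℝ := ∑ j ∈ Finset.range n, q ^ j

/-- The monic polynomials `Q_n(y|x,s,t)` in the variable `y`, given by `Q_0 = 1`, `Q_1 = y - x` and
`y Q_n = Q_{n+1} + (θ [n]_q + x q^n) Q_n + (t - s q^(n-1) + τ [n-1]_q) [n]_q Q_{n-1}`, `n ≥ 1`. -/
def Q (q θ τ s t x : ℝ) : ℕ → ℝ[X]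
  | 0 => 1
  | 1 => Polynomial.X - Polynomial.C x
  | n + 2 =>
      (Polynomial.X - Polynomial.C (θ * qInt q (n + 1) + x * q ^ (n + 1))) * Q q θ τ s t x (n + 1)
        - Polynomial.C ((t - s * q ^ n + τ * qInt q n) * qInt q (n + 1)) * Q q θ τ s t x n

/-- `μ` is a probability measure with finite moments of all orders with respect to which the
polynomials `R 0, R 1, ...` are pairwise orthogonal. -/
structure IsOrthogonalityMeasure (R : ℕ → ℝ[X]) (μ : Measure ℝ) : Prop where
  isProbabilityMeasure : IsProbabilityMeasure μ
  integrable_pow : ∀ n : ℕ, Integrable (fun y : ℝ => y ^ n) μ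
  orthogonal : ∀ m n : ℕ, m ≠ n → ∫ y, (R m).eval y * (R n).eval y ∂μ = 0

open Classical in
/-- The transition probability `P_{s,t}(x, dy)` of the `q`-Meixner process with parameters `θ, τ`:
the orthogonality measure of the polynomials `Q_n(y|x,s,t)`. -/
def transition (q θ τ s t x : ℝ) : Measure ℝ :=
  if h : ∃ μ : Measure ℝ, IsOrthogonalityMeasure (Q q θ τ s t x) μ then h.choose else 0

/-- The transition operator `(P_{s,t} f)(x) = ∫ f(y) P_{s,t}(x, dy)`. -/
def transitionOp (q θ τ s t : ℝ) (f : ℝ → ℝ) (x : ℝ) : ℝ :=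
  ∫ y, f y ∂(transition q θ τ s t x)

/-- `(P_{t-h,t} f - f)(x) / h`. -/
def leftQuotient (q θ τ t : ℝ) (f : ℝ → ℝ) (h x : ℝ) : ℝ :=
  (1 / h) * (transitionOp q θ τ (t - h) t f x - f x)

/-- `(P_{t,t+h} f - f)(x) / h`. -/
def rightQuotient (q θ τ t : ℝ) (f : ℝ → ℝ) (h x : ℝ) : ℝ :=
  (1 / h) * (transitionOp q θ τ t (t + h) f x - f x)

/-- The domain of the weak left generator at time `t`: the bounded continuous functions for which
the left quotients converge pointwise as `h → 0+` and are uniformly bounded. -/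
def weakLeftDomain (q θ τ t : ℝ) : Set (ℝ →ᵇ ℝ) :=
  {f | (∀ x, ∃ l, Tendsto (fun h => leftQuotient q θ τ t f h x) (𝓝[>] 0) (𝓝 l)) ∧
    ∃ C, ∀ h ∈ Ioc 0 t, ∀ x, |leftQuotient q θ τ t f h x| ≤ C}

/-- The domain of the weak right generator at time `t`. -/
def weakRightDomain (q θ τ t : ℝ) : Set (ℝ →ᵇ ℝ) :=
  {f | (∀ x, ∃ l, Tendsto (fun h => rightQuotient q θ τ t f h x) (𝓝[>] 0) (𝓝 l)) ∧
    ∃ C, ∀ h ∈ Ioi (0 : ℝ), ∀ x, |rightQuotient q θ τ t f h x| ≤ C}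

/-- The weak left generator, `lim_{h → 0+} (P_{t-h,t} f - f) / h` (meaningful on the domain). -/
def weakLeftGenerator (q θ τ t : ℝ) (f : ℝ →ᵇ ℝ) (x : ℝ) : ℝ :=
  limUnder (𝓝[>] (0 : ℝ)) (fun h => leftQuotient q θ τ t f h x)

/-- The weak right generator, `lim_{h → 0+} (P_{t,t+h} f - f) / h` (meaningful on the domain). -/
def weakRightGenerator (q θ τ t : ℝ) (f : ℝ →ᵇ ℝ) (x : ℝ) : ℝ :=
  limUnder (𝓝[>] (0 : ℝ)) (fun h => rightQuotient q θ τ t f h x)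

/-- The partial derivative `∂/∂x ((f(y) - f(x)) / (y - x))`, with `y` fixed. -/
def diffQuotDeriv (f : ℝ → ℝ) (x y : ℝ) : ℝ :=
  deriv (fun z => (f y - f z) / (y - z)) x

/-- The semicircle law with mean `m` and variance `v > 0`, with density
`√(4v - (y - m)²) / (2πv)` on `(m - 2√v, m + 2√v)` (elsewhere the real square root is `0`). -/
def semicircle (m v : ℝ) : Measure ℝ :=
  volume.withDensity fun y => ENNReal.ofReal (√(4 * v - (y - m) ^ 2) / (2 * Real.pi * v))

end QMeixner

end

open QMeixner

/-! At `q = 0` the recurrence has constant coefficients after its first steps: the Jacobi matrix has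
diagonal `x, θ, θ, ...` and squared off-diagonal `t - s, t + τ, t + τ, ...`. Deleting its first row
and column leaves the Jacobi matrix of the semicircle law `w` of mean `θ` and variance `t + τ`. In
terms of Cauchy transforms, `1 / G(z) = z - x - (t - s) G_w(z)`.

Tested on polynomials this reads `∫ (y - x) p(y) μ(dy) = (t - s) ∫∫ p[y, z] w(dz) μ(dy)` with `μ =
P_{s,t}(x, ·)` (`integral_sub_mul_eval_eq`). Taking `p = f[x, ·]` gives the exact formula `(P_{s,t}
f - f)(x) = (t - s) ∫∫ f[x, y, z] w(dz) μ(dy)`, which passes from polynomials to C² functions by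
Weierstrass approximation of `f''` (`integral_sub_eq_semicircleMean`).

So both generator quotients are averages of second divided differences. This bounds them by `sup
|f''|`. As the time step `h` shrinks, `μ` has variance `h` about `x` and concentrates there, while
`w` depends continuously on the end time. The limit is `∫ f[x, x, z] w(dz)`, and `f[x, x, z]` is the
`x`-derivative of the difference quotient.

The measures exist by the spectral theorem for the bounded Jacobi operator. They are unique because
orthogonality fixes all moments, and moments determine a compactly supported measure. -/

/-! ### Scalar spectral measures of bounded self-adjoint operators -/

section SpectralMeasure

open scoped CompactlySupported InnerProductSpace

variable {H : Type*} [NormedAddCommGroup H] [InnerProductSpace ℂ H] [CompleteSpace H]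

/-- The positive functional `f ↦ ⟪e, f(T) e⟫` on the continuous functions on the spectrum of a
bounded self-adjoint operator `T`. -/
noncomputable def spectralFunctional (T : H →L[ℂ] H) (hT : IsSelfAdjoint T) (e : H) :
    C_c(spectrum ℝ T, ℝ) →ₚ[ℝ] ℝ :=
  PositiveLinearMap.mk₀
    { toFun := fun f => (⟪e, cfcHom hT (f : C(spectrum ℝ T, ℝ)) e⟫_ℂ).re
      map_add' := fun f g => by
        have : ((f + g : C_c(spectrum ℝ T, ℝ)) : C(spectrum ℝ T, ℝ))
            = (f : C(spectrum ℝ T, ℝ)) + (g : C(spectrum ℝ T, ℝ)) := rfl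
        rw [this, map_add, add_apply, inner_add_right, Complex.add_re]
      map_smul' := fun c f => by
        have : ((c • f : C_c(spectrum ℝ T, ℝ)) : C(spectrum ℝ T, ℝ))
            = c • (f : C(spectrum ℝ T, ℝ)) := rfl
        rw [this, map_smul, smul_apply, inner_smul_right_eq_smul]
        simp }
    (fun f hf => by
      -- Positivity: `f = g²` with `g = √f`, so the functional takes the value `‖g(T) e‖²`.
      let g : C(spectrum ℝ T, ℝ) := ⟨fun y => √(f y), by fun_prop⟩
      have hg : (f : C(spectrum ℝ T, ℝ)) = star g * g := by
        ext y
        simpa [g] using (Real.mul_self_sqrt (hf y)).symm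
      change 0 ≤ (⟪e, cfcHom hT (f : C(spectrum ℝ T, ℝ)) e⟫_ℂ).re
      rw [hg, map_mul, map_star, ContinuousLinearMap.star_eq_adjoint,
        mul_apply_eq_comp, ContinuousLinearMap.adjoint_inner_right]
      exact inner_self_nonneg (𝕜 := ℂ))

/-- The scalar spectral measure of a bounded self-adjoint operator. -/
theorem exists_spectralMeasure [Nontrivial H] (T : H →L[ℂ] H) (hT : IsSelfAdjoint T) (e : H) :
    ∃ μ : Measure ℝ, IsFiniteMeasure μ ∧ μ (Icc (-‖T‖) ‖T‖)ᶜ = 0 ∧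
      ∀ p : ℝ[X], ∫ y, p.eval y ∂μ = (⟪e, Polynomial.aeval T p e⟫_ℂ).re := by
  have : CompactSpace (spectrum ℝ T) := isCompact_iff_compactSpace.mp
    (ContinuousFunctionalCalculus.isCompact_spectrum T)
  set ν := RealRMK.rieszMeasure (spectralFunctional T hT e) with hν
  have hemb : MeasurableEmbedding (Subtype.val : spectrum ℝ T → ℝ) :=
    MeasurableEmbedding.subtype_coe
      (ContinuousFunctionalCalculus.isCompact_spectrum T).isClosed.measurableSet
  refine ⟨ν.map Subtype.val, ?_, ?_, fun p => ?_⟩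
  · have : IsFiniteMeasure ν := ⟨isCompact_univ.measure_lt_top⟩
    infer_instance
  · rw [hemb.map_apply]
    convert measure_empty (μ := ν)
    ext ⟨y, hy⟩
    simp only [mem_preimage, mem_compl_iff, mem_Icc, mem_empty_iff_false, iff_false, not_not]
    exact abs_le.mp (by simpa using spectrum.norm_le_norm_of_mem hy)
  · rw [hemb.integral_map]
    let f : C(spectrum ℝ T, ℝ) := ⟨fun y => p.eval (y : ℝ), by fun_prop⟩
    have h := RealRMK.integral_rieszMeasure (spectralFunctional T hT e)
      (CompactlySupportedContinuousMap.continuousMapEquiv f)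
    have hf : cfcHom hT f = Polynomial.aeval T p := by
      rw [← cfc_polynomial (R := ℝ) p T hT, cfc_apply p.eval T hT]
      rfl
    rw [← hf]
    exact h

end SpectralMeasure

/-! ### Jacobi operators that are constant up to finite rank -/

section JacobiOperator

open scoped InnerProductSpace
open ContinuousLinearMap InnerProductSpace

variable {H : Type*} [NormedAddCommGroup H] [InnerProductSpace ℂ H]

theorem HilbertBasis.inner_basis (b : HilbertBasis ℕ ℂ H) (m n : ℕ) :
    ⟪b m, b n⟫_ℂ = if m = n then 1 else 0 :=
  orthonormal_iff_ite.mp b.orthonormal m n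

theorem HilbertBasis.ext_inner (b : HilbertBasis ℕ ℂ H) {u v : H}
    (h : ∀ n, ⟪b n, u⟫_ℂ = ⟪b n, v⟫_ℂ) : u = v := by
  apply b.repr.injective
  ext n
  simpa [b.repr_apply_apply] using h n

variable [CompleteSpace H]

/-- The unilateral shift along a Hilbert basis. -/
noncomputable def basisShift (b : HilbertBasis ℕ ℂ H) : H →L[ℂ] H :=
  ((b.orthonormal.comp Nat.succ Nat.succ_injective).orthogonalFamily.linearIsometry.comp
    b.repr.toLinearIsometry).toContinuousLinearMap

theorem basisShift_apply_basis (b : HilbertBasis ℕ ℂ H) (n : ℕ) :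
    basisShift b (b n) = b (n + 1) := by
  classical
  change (b.orthonormal.comp Nat.succ Nat.succ_injective).orthogonalFamily.linearIsometry
    (b.repr (b n)) = _
  rw [b.repr_self, OrthogonalFamily.linearIsometry_apply_single]
  simp

theorem norm_basisShift_le (b : HilbertBasis ℕ ℂ H) : ‖basisShift b‖ ≤ 1 :=
  LinearIsometry.norm_toContinuousLinearMap_le _

theorem adjoint_basisShift_apply_basis_succ (b : HilbertBasis ℕ ℂ H) (n : ℕ) :
    adjoint (basisShift b) (b (n + 1)) = b n := by
  refine b.ext_inner fun m => ?_
  rw [adjoint_inner_right, basisShift_apply_basis, b.inner_basis, b.inner_basis]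
  simp

theorem adjoint_basisShift_apply_basis_zero (b : HilbertBasis ℕ ℂ H) :
    adjoint (basisShift b) (b 0) = 0 := by
  refine b.ext_inner fun m => ?_
  rw [adjoint_inner_right, basisShift_apply_basis, b.inner_basis]
  simp

/-- The Jacobi operator with diagonal `x, θ, θ, ...` and off-diagonal `α, β, β, ...`. -/
noncomputable def jacobiOperator (b : HilbertBasis ℕ ℂ H) (x θ α β : ℝ) : H →L[ℂ] H :=
  θ • (1 : H →L[ℂ] H) + β • (basisShift b + adjoint (basisShift b))
    + (x - θ) • rankOne ℂ (b 0) (b 0)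
    + (α - β) • (rankOne ℂ (b 1) (b 0) + rankOne ℂ (b 0) (b 1))

theorem isSelfAdjoint_jacobiOperator (b : HilbertBasis ℕ ℂ H) (x θ α β : ℝ) :
    IsSelfAdjoint (jacobiOperator b x θ α β) := by
  have h1 : IsSelfAdjoint (basisShift b + adjoint (basisShift b)) := by
    simp [isSelfAdjoint_iff, star_eq_adjoint, add_comm]
  have h2 : IsSelfAdjoint (rankOne ℂ (b 0) (b 0)) := by
    simp [isSelfAdjoint_iff, star_eq_adjoint]
  have h3 : IsSelfAdjoint (rankOne ℂ (b 1) (b 0) + rankOne ℂ (b 0) (b 1)) := by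
    simp [isSelfAdjoint_iff, star_eq_adjoint, add_comm]
  have hr : ∀ r : ℝ, IsSelfAdjoint r := fun r => IsSelfAdjoint.all r
  exact ((((hr θ).smul (IsSelfAdjoint.one _)).add ((hr β).smul h1)).add ((hr _).smul h2)).add
    ((hr _).smul h3)

theorem norm_jacobiOperator_le (b : HilbertBasis ℕ ℂ H) (x θ α β : ℝ) :
    ‖jacobiOperator b x θ α β‖ ≤ |θ| + 2 * |β| + |x - θ| + 2 * |α - β| := by
  have hS := norm_basisShift_le b
  have hn : ∀ n, ‖b n‖ = 1 := b.orthonormal.1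
  have h0 : ‖θ • (1 : H →L[ℂ] H)‖ ≤ |θ| := by
    rw [norm_smul, Real.norm_eq_abs]
    exact mul_le_of_le_one_right (abs_nonneg _) norm_id_le
  have h1 : ‖β • (basisShift b + adjoint (basisShift b))‖ ≤ 2 * |β| := by
    rw [norm_smul, Real.norm_eq_abs, mul_comm]
    refine mul_le_mul_of_nonneg_right ((norm_add_le _ _).trans ?_) (abs_nonneg _)
    rw [LinearIsometryEquiv.norm_map]
    linarith
  have h2 : ‖(x - θ) • rankOne ℂ (b 0) (b 0)‖ ≤ |x - θ| := by
    simp [norm_smul, hn]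
  have h3 : ‖(α - β) • (rankOne ℂ (b 1) (b 0) + rankOne ℂ (b 0) (b 1))‖ ≤ 2 * |α - β| := by
    rw [norm_smul, Real.norm_eq_abs, mul_comm]
    refine mul_le_mul_of_nonneg_right ((norm_add_le _ _).trans ?_) (abs_nonneg _)
    simp only [norm_rankOne, hn]
    norm_num
  exact (norm_add_le _ _).trans (add_le_add ((norm_add_le _ _).trans
    (add_le_add ((norm_add_le _ _).trans (add_le_add h0 h1)) h2)) h3)

theorem jacobiOperator_apply_basis_zero (b : HilbertBasis ℕ ℂ H) (x θ α β : ℝ) :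
    jacobiOperator b x θ α β (b 0) = x • b 0 + α • b 1 := by
  simp only [jacobiOperator, add_apply, smul_apply, one_apply_eq_self, rankOne_apply,
    b.inner_basis, basisShift_apply_basis, adjoint_basisShift_apply_basis_zero]
  norm_num
  module

theorem jacobiOperator_apply_basis_one (b : HilbertBasis ℕ ℂ H) (x θ α β : ℝ) :
    jacobiOperator b x θ α β (b 1) = α • b 0 + θ • b 1 + β • b 2 := by
  simp only [jacobiOperator, add_apply, smul_apply, one_apply_eq_self, rankOne_apply,
    b.inner_basis, basisShift_apply_basis, adjoint_basisShift_apply_basis_succ b 0]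
  norm_num
  module

theorem jacobiOperator_apply_basis_add_two (b : HilbertBasis ℕ ℂ H) (x θ α β : ℝ) (n : ℕ) :
    jacobiOperator b x θ α β (b (n + 2))
      = β • b (n + 1) + θ • b (n + 2) + β • b (n + 3) := by
  simp only [jacobiOperator, add_apply, smul_apply, one_apply_eq_self, rankOne_apply,
    b.inner_basis, basisShift_apply_basis, adjoint_basisShift_apply_basis_succ b (n + 1)]
  norm_num
  module

end JacobiOperator

/-! ### The recurrence at `q = 0` and existence of the orthogonality measure -/

theorem Q_zero_one (θ τ s t x : ℝ) : Q 0 θ τ s t x 1 = Polynomial.X - Polynomial.C x := rfl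

theorem Q_zero_two (θ τ s t x : ℝ) : Q 0 θ τ s t x 2 =
    (Polynomial.X - Polynomial.C θ) * Q 0 θ τ s t x 1 - Polynomial.C (t - s) := by
  rw [Q]
  simp [qInt, Q]

theorem Q_zero_add_three (θ τ s t x : ℝ) (n : ℕ) : Q 0 θ τ s t x (n + 3) =
    (Polynomial.X - Polynomial.C θ) * Q 0 θ τ s t x (n + 2)
      - Polynomial.C (t + τ) * Q 0 θ τ s t x (n + 1) := by
  rw [Q]
  simp [qInt, Finset.sum_range_succ']

section

open scoped InnerProductSpace

variable {H : Type*} [NormedAddCommGroup H] [InnerProductSpace ℂ H] [CompleteSpace H]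

/-- The recurrence of `Q` is the action of the Jacobi operator on the basis up to normalization, so
applying the polynomials to the first basis vector produces multiples of the orthonormal basis.
Orthogonality under the spectral measure follows; the multiple may vanish when `s = t`. -/
theorem aeval_jacobiOperator_Q (b : HilbertBasis ℕ ℂ H) (θ τ s t x : ℝ) (hst : s ≤ t)
    (htτ : 0 ≤ t + τ) (n : ℕ) :
    Polynomial.aeval (jacobiOperator b x θ √(t - s) √(t + τ)) (Q 0 θ τ s t x (n + 1)) (b 0)
      = (√(t - s) * √(t + τ) ^ n) • b (n + 1) := by
  have ha : √(t - s) * √(t - s) = t - s := Real.mul_self_sqrt (by linarith)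
  have hv : √(t + τ) * √(t + τ) = t + τ := Real.mul_self_sqrt htτ
  set T := jacobiOperator b x θ √(t - s) √(t + τ) with hT
  induction n using Nat.strong_induction_on with
  | _ n ih =>
    match n with
    | 0 =>
      simp only [Q_zero_one, map_sub, Polynomial.aeval_X, Polynomial.aeval_C, sub_apply,
        Algebra.algebraMap_eq_smul_one, smul_apply, one_apply_eq_self, zero_add, pow_zero, mul_one]
      rw [hT, jacobiOperator_apply_basis_zero]
      module
    | 1 =>
      have h := ih 0 one_pos
      simp only [zero_add, pow_zero, mul_one] at h
      simp only [Nat.reduceAdd, Q_zero_two, map_sub, map_mul, Polynomial.aeval_X,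
        Polynomial.aeval_C, sub_apply, mul_apply_eq_comp,
        Algebra.algebraMap_eq_smul_one, smul_apply, one_apply_eq_self, h, ContinuousLinearMap.map_smul_of_tower]
      rw [hT, jacobiOperator_apply_basis_one]
      linear_combination (norm := module) ha • (b 0)
    | n + 2 =>
      have h1 := ih (n + 1) (by omega)
      have h0 := ih n (by omega)
      simp only [Q_zero_add_three, map_sub, map_mul, Polynomial.aeval_X,
        Polynomial.aeval_C, sub_apply, mul_apply_eq_comp,
        Algebra.algebraMap_eq_smul_one, smul_apply, one_apply_eq_self, h1, h0, smul_mul_assoc,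
        one_mul, ContinuousLinearMap.map_smul_of_tower]
      rw [hT, jacobiOperator_apply_basis_add_two]
      have hv' := congrArg (fun r : ℝ => (√(t - s) * √(t + τ) ^ n * r)) hv
      linear_combination (norm := module) hv' • (b (n + 1))

end

theorem ae_mem_of_measure_compl_eq_zero {μ : Measure ℝ} {K : Set ℝ} (h : μ Kᶜ = 0) :
    ∀ᵐ y ∂μ, y ∈ K := by
  exact ae_iff.mpr h

theorem Continuous.integrable_of_measure_compl_Icc_eq_zero {μ : Measure ℝ} [IsFiniteMeasure μ]
    {f : ℝ → ℝ} (hf : Continuous f) {a b : ℝ} (h : μ (Icc a b)ᶜ = 0) : Integrable f μ := by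
  obtain ⟨C, hC⟩ := (isCompact_Icc (a := a) (b := b)).exists_bound_of_continuousOn
    hf.continuousOn
  refine Integrable.of_bound hf.aestronglyMeasurable C ?_
  filter_upwards [ae_mem_of_measure_compl_eq_zero h] with y hy using hC y hy

/-- A bound for the support of the orthogonality measure. -/
noncomputable def supportBound (θ τ s t x : ℝ) : ℝ :=
  |θ| + 2 * √(t + τ) + |x - θ| + 2 * |√(t - s) - √(t + τ)|

open scoped InnerProductSpace in
theorem exists_isOrthogonalityMeasure_of_hilbertBasis {H : Type*} [NormedAddCommGroup H]
    [InnerProductSpace ℂ H] [CompleteSpace H] (b : HilbertBasis ℕ ℂ H)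
    (θ τ s t x : ℝ) (hst : s ≤ t) (htτ : 0 ≤ t + τ) :
    ∃ μ : Measure ℝ, IsOrthogonalityMeasure (Q 0 θ τ s t x) μ ∧
      μ (Icc (-supportBound θ τ s t x) (supportBound θ τ s t x))ᶜ = 0 := by
  have : Nontrivial H := ⟨b 0, 0, b.orthonormal.ne_zero 0⟩
  set T := jacobiOperator b x θ √(t - s) √(t + τ) with hT
  have hsa : IsSelfAdjoint T := isSelfAdjoint_jacobiOperator ..
  obtain ⟨μ, hfin, hsupp, hμ⟩ := exists_spectralMeasure T hsa (b 0)
  have hQ : ∀ n, ∃ c : ℝ, Polynomial.aeval T (Q 0 θ τ s t x n) (b 0) = c • b n := by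
    rintro (_ | n)
    · exact ⟨1, by simp [Q]⟩
    · exact ⟨_, aeval_jacobiOperator_Q b θ τ s t x hst htτ n⟩
  refine ⟨μ, ⟨⟨?_⟩, fun n => ?_, fun m n hmn => ?_⟩, ?_⟩
  · have h := hμ 1
    have h0 : ⟪b 0, b 0⟫_ℂ = 1 := by rw [b.inner_basis, if_pos rfl]
    simp only [Polynomial.eval_one, map_one, one_apply_eq_self, h0, Complex.one_re] at h
    rw [integral_const, smul_eq_mul, mul_one, measureReal_def] at h
    rw [← ENNReal.ofReal_toReal (measure_ne_top μ univ), h, ENNReal.ofReal_one]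
  · exact (continuous_pow n).integrable_of_measure_compl_Icc_eq_zero hsupp
  · obtain ⟨c, hc⟩ := hQ m
    obtain ⟨d, hd⟩ := hQ n
    have h := hμ (Q 0 θ τ s t x m * Q 0 θ τ s t x n)
    -- A real polynomial in a self-adjoint operator is self-adjoint, so one factor moves to the left
    -- slot of the inner product.
    have hm : IsSelfAdjoint (Polynomial.aeval T (Q 0 θ τ s t x m)) := by
      rw [← cfc_polynomial (R := ℝ) _ T hsa]
      exact cfc_predicate _ _
    simp only [Polynomial.eval_mul] at h
    rw [h, map_mul, mul_apply_eq_comp, hd, ← ContinuousLinearMap.adjoint_inner_left,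
      hm.adjoint_eq, hc, inner_smul_left_eq_smul, inner_smul_right_eq_smul, b.inner_basis,
      if_neg hmn]
    simp
  · have hn : ‖T‖ ≤ supportBound θ τ s t x := by
      refine (norm_jacobiOperator_le ..).trans_eq ?_
      rw [supportBound, abs_of_nonneg (Real.sqrt_nonneg _)]
    exact measure_mono_null (compl_subset_compl.mpr (Icc_subset_Icc (neg_le_neg hn) hn)) hsupp

theorem exists_isOrthogonalityMeasure (θ τ s t x : ℝ) (hst : s ≤ t) (htτ : 0 ≤ t + τ) :
    ∃ μ : Measure ℝ, IsOrthogonalityMeasure (Q 0 θ τ s t x) μ ∧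
      μ (Icc (-supportBound θ τ s t x) (supportBound θ τ s t x))ᶜ = 0 :=
  exists_isOrthogonalityMeasure_of_hilbertBasis
    -- The identity of `ℓ²(ℕ)` is its standard Hilbert basis.
    (⟨LinearIsometryEquiv.refl _ _⟩ : HilbertBasis ℕ ℂ (lp (fun _ : ℕ => ℂ) 2)) θ τ s t x hst htτ

/-! ### Uniqueness: moments, support, determinacy -/

theorem Polynomial.submodule_eq_top_of_X_mul_mem {W : Submodule ℝ ℝ[X]} (h1 : 1 ∈ W)
    (hX : ∀ p ∈ W, Polynomial.X * p ∈ W) : W = ⊤ := by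
  have hpow : ∀ n : ℕ, (Polynomial.X : ℝ[X]) ^ n ∈ W := fun n => by
    induction n with
    | zero => simpa using h1
    | succ n ih => simpa [pow_succ'] using hX _ ih
  refine (Submodule.eq_top_iff').mpr fun p => ?_
  rw [p.as_sum_range_C_mul_X_pow]
  refine Submodule.sum_mem _ fun n _ => ?_
  rw [← Polynomial.smul_eq_C_mul]
  exact W.smul_mem _ (hpow n)

theorem span_range_Q_zero (θ τ s t x : ℝ) :
    Submodule.span ℝ (range (Q 0 θ τ s t x)) = ⊤ := by
  set W := Submodule.span ℝ (range (Q 0 θ τ s t x)) with hW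
  have hmem : ∀ n, Q 0 θ τ s t x n ∈ W := fun n => Submodule.subset_span ⟨n, rfl⟩
  refine Polynomial.submodule_eq_top_of_X_mul_mem (hmem 0) fun p hp => ?_
  induction hp using Submodule.span_induction with
  | mem p hp =>
    obtain ⟨n, rfl⟩ := hp
    match n with
    | 0 =>
      have : Polynomial.X * Q 0 θ τ s t x 0 = Q 0 θ τ s t x 1 + x • Q 0 θ τ s t x 0 := by
        simp only [Q, Polynomial.smul_eq_C_mul]
        ring
      rw [this]
      exact W.add_mem (hmem 1) (W.smul_mem _ (hmem 0))
    | 1 =>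
      have : Polynomial.X * Q 0 θ τ s t x 1
          = Q 0 θ τ s t x 2 + θ • Q 0 θ τ s t x 1 + (t - s) • Q 0 θ τ s t x 0 := by
        simp only [Q_zero_two, Polynomial.smul_eq_C_mul]
        simp only [Q]
        ring
      rw [this]
      exact W.add_mem (W.add_mem (hmem 2) (W.smul_mem _ (hmem 1))) (W.smul_mem _ (hmem 0))
    | n + 2 =>
      have : Polynomial.X * Q 0 θ τ s t x (n + 2)
          = Q 0 θ τ s t x (n + 3) + θ • Q 0 θ τ s t x (n + 2)
            + (t + τ) • Q 0 θ τ s t x (n + 1) := by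
        simp only [Q_zero_add_three, Polynomial.smul_eq_C_mul]
        ring
      rw [this]
      exact W.add_mem (W.add_mem (hmem _) (W.smul_mem _ (hmem _))) (W.smul_mem _ (hmem _))
  | zero => simp
  | add p q _ _ hp hq => rw [mul_add]; exact W.add_mem hp hq
  | smul c p _ hp => rw [mul_smul_comm]; exact W.smul_mem _ hp

theorem integrable_eval_of_integrable_pow {μ : Measure ℝ}
    (h : ∀ n : ℕ, Integrable (fun y : ℝ => y ^ n) μ) (p : ℝ[X]) :
    Integrable (fun y => p.eval y) μ := by
  simp only [Polynomial.eval_eq_sum_range]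
  exact integrable_finsetSum _ fun n _ => (h n).const_mul _

theorem QMeixner.IsOrthogonalityMeasure.integral_Q_succ {θ τ s t x : ℝ} {μ : Measure ℝ}
    (h : IsOrthogonalityMeasure (Q 0 θ τ s t x) μ) (n : ℕ) :
    ∫ y, (Q 0 θ τ s t x (n + 1)).eval y ∂μ = 0 := by
  simpa [Q] using h.orthogonal (n + 1) 0 (Nat.succ_ne_zero n)

/-- Orthogonality to `Q 0 = 1` makes every later `Q n` integrate to zero, and the `Q n` span all
polynomials. -/
theorem integral_eval_eq_of_isOrthogonalityMeasure {θ τ s t x : ℝ} {μ ν : Measure ℝ}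
    (hμ : IsOrthogonalityMeasure (Q 0 θ τ s t x) μ)
    (hν : IsOrthogonalityMeasure (Q 0 θ τ s t x) ν) (p : ℝ[X]) :
    ∫ y, p.eval y ∂μ = ∫ y, p.eval y ∂ν := by
  have := hμ.isProbabilityMeasure
  have := hν.isProbabilityMeasure
  have iμ := integrable_eval_of_integrable_pow hμ.integrable_pow
  have iν := integrable_eval_of_integrable_pow hν.integrable_pow
  have hp : p ∈ Submodule.span ℝ (range (Q 0 θ τ s t x)) := by simp [span_range_Q_zero]
  induction hp using Submodule.span_induction with
  | mem p hp =>
    obtain ⟨_ | n, rfl⟩ := hp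
    · simp [Q]
    · rw [hμ.integral_Q_succ, hν.integral_Q_succ]
  | zero => simp
  | add p q _ _ hp hq =>
    simp only [Polynomial.eval_add]
    rw [integral_add (iμ p) (iμ q), integral_add (iν p) (iν q), hp, hq]
  | smul c p _ hp =>
    simp only [Polynomial.eval_smul, smul_eq_mul]
    rw [integral_const_mul, integral_const_mul, hp]

/-- A measure with the moments of a measure on `[-M, M]` is carried by `[-M, M]`. -/
theorem measure_compl_Icc_eq_zero_of_moments {μ ν : Measure ℝ} [IsProbabilityMeasure μ]
    [IsFiniteMeasure ν] {M : ℝ} (hM : 0 ≤ M) (hμ : μ (Icc (-M) M)ᶜ = 0)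
    (hi : ∀ n : ℕ, Integrable (fun y : ℝ => y ^ n) ν)
    (h : ∀ n : ℕ, ∫ y, y ^ n ∂μ = ∫ y, y ^ n ∂ν) : ν (Icc (-M) M)ᶜ = 0 := by
  -- Markov's inequality for `y ^ (2 * k)` bounds this mass by `(M / r) ^ (2 * k)`, which tends to
  -- zero as `k` grows.
  have key : ∀ r, M < r → ν {y | r ≤ |y|} = 0 := fun r hr => by
    have hr0 : 0 < r := hM.trans_lt hr
    have hle : ∀ k : ℕ, ν.real {y | r ≤ |y|} ≤ ((M / r) ^ 2) ^ k := fun k => by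
      have h1 : ∫ y, y ^ (2 * k) ∂μ ≤ M ^ (2 * k) := by
        calc ∫ y, y ^ (2 * k) ∂μ ≤ ∫ _, M ^ (2 * k) ∂μ := by
              refine integral_mono_ae
                ((continuous_pow _).integrable_of_measure_compl_Icc_eq_zero hμ)
                (integrable_const _) ?_
              filter_upwards [ae_mem_of_measure_compl_eq_zero hμ] with y hy
              rw [pow_mul, pow_mul]
              exact pow_le_pow_left₀ (sq_nonneg y) (sq_le_sq' hy.1 hy.2) k
          _ = M ^ (2 * k) := by simp
      have h2 := mul_meas_ge_le_integral_of_nonneg (μ := ν) (f := fun y => y ^ (2 * k))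
        (ae_of_all _ fun y => (even_two_mul k).pow_nonneg y) (hi _) (r ^ (2 * k))
      have h3 : {y : ℝ | r ≤ |y|} ⊆ {y | r ^ (2 * k) ≤ y ^ (2 * k)} := fun y hy => by
        have := pow_le_pow_left₀ hr0.le hy (2 * k)
        rwa [(even_two_mul k).pow_abs] at this
      have h4 := measureReal_mono (μ := ν) h3
      rw [← pow_mul, div_pow, le_div_iff₀ (by positivity), mul_comm]
      calc r ^ (2 * k) * ν.real {y | r ≤ |y|}
          ≤ r ^ (2 * k) * ν.real {y | r ^ (2 * k) ≤ y ^ (2 * k)} := by gcongr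
        _ ≤ M ^ (2 * k) := h2.trans (h _ ▸ h1)
    have hlt : (M / r) ^ 2 < 1 := by
      rw [sq_lt_one_iff₀ (by positivity), div_lt_one hr0]
      exact hr
    have h0 := ge_of_tendsto' (tendsto_pow_atTop_nhds_zero_of_lt_one (sq_nonneg _) hlt) hle
    exact (measureReal_eq_zero_iff).mp (le_antisymm h0 measureReal_nonneg)
  have hsub : (Icc (-M) M)ᶜ ⊆ ⋃ n : ℕ, {y : ℝ | M + 1 / (n + 1) ≤ |y|} := fun y hy => by
    have hy' : M < |y| := by
      by_contra hcon
      exact hy (abs_le.mp (not_lt.mp hcon))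
    obtain ⟨n, hn⟩ := exists_nat_one_div_lt (sub_pos.mpr hy')
    exact mem_iUnion.mpr ⟨n, by simp only [mem_ofPred_eq]; linarith⟩
  refine measure_mono_null hsub (measure_iUnion_null fun n => key _ ?_)
  have : (0 : ℝ) < 1 / (n + 1) := by positivity
  linarith

theorem abs_integral_le_of_measure_compl_Icc {μ : Measure ℝ} [IsProbabilityMeasure μ] {a b ε : ℝ}
    (hμ : μ (Icc a b)ᶜ = 0) {f : ℝ → ℝ} (h : ∀ y ∈ Icc a b, |f y| ≤ ε) :
    |∫ y, f y ∂μ| ≤ ε := by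
  have := norm_integral_le_of_norm_le_const (μ := μ) (f := f) (C := ε) (by
    filter_upwards [ae_mem_of_measure_compl_eq_zero hμ] with y hy using h y hy)
  simpa using this

theorem measure_eq_of_integral_eval_eq {μ ν : Measure ℝ} [IsProbabilityMeasure μ]
    [IsProbabilityMeasure ν] {M : ℝ} (hμ : μ (Icc (-M) M)ᶜ = 0) (hν : ν (Icc (-M) M)ᶜ = 0)
    (h : ∀ p : ℝ[X], ∫ y, p.eval y ∂μ = ∫ y, p.eval y ∂ν) : μ = ν := by
  refine ext_of_forall_integral_eq_of_IsFiniteMeasure fun f => ?_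
  -- By Weierstrass, each test function is uniformly close on `[-M, M]` to a polynomial, whose two
  -- integrals agree.
  refine eq_of_forall_dist_le fun ε hε => ?_
  obtain ⟨p, hp⟩ := exists_polynomial_near_of_continuousOn (-M) M f f.continuous.continuousOn
    (ε / 2) (half_pos hε)
  have hp' : ∀ y ∈ Icc (-M) M, |f y - p.eval y| ≤ ε / 2 := fun y hy => by
    rw [abs_sub_comm]
    exact (hp y hy).le
  have h1 := abs_integral_le_of_measure_compl_Icc hμ hp'
  have h2 := abs_integral_le_of_measure_compl_Icc hν hp'
  rw [integral_sub (f.continuous.integrable_of_measure_compl_Icc_eq_zero hμ)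
    (p.continuous.integrable_of_measure_compl_Icc_eq_zero hμ)] at h1
  rw [integral_sub (f.continuous.integrable_of_measure_compl_Icc_eq_zero hν)
    (p.continuous.integrable_of_measure_compl_Icc_eq_zero hν)] at h2
  rw [Real.dist_eq, abs_le]
  rw [abs_le] at h1 h2
  rw [h p] at h1
  constructor <;> linarith

theorem supportBound_nonneg (θ τ s t x : ℝ) : 0 ≤ supportBound θ τ s t x := by
  unfold supportBound
  positivity

theorem QMeixner.IsOrthogonalityMeasure.measure_compl_Icc {θ τ s t x : ℝ} (hst : s ≤ t)
    (htτ : 0 ≤ t + τ) {ν : Measure ℝ} (h : IsOrthogonalityMeasure (Q 0 θ τ s t x) ν) :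
    ν (Icc (-supportBound θ τ s t x) (supportBound θ τ s t x))ᶜ = 0 := by
  obtain ⟨μ, hμ, hsupp⟩ := exists_isOrthogonalityMeasure θ τ s t x hst htτ
  have := hμ.isProbabilityMeasure
  have := h.isProbabilityMeasure
  exact measure_compl_Icc_eq_zero_of_moments (supportBound_nonneg ..) hsupp h.integrable_pow
    fun n => by simpa using integral_eval_eq_of_isOrthogonalityMeasure hμ h (Polynomial.X ^ n)

theorem QMeixner.IsOrthogonalityMeasure.unique {θ τ s t x : ℝ} (hst : s ≤ t)
    (htτ : 0 ≤ t + τ) {μ ν : Measure ℝ} (hμ : IsOrthogonalityMeasure (Q 0 θ τ s t x) μ)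
    (hν : IsOrthogonalityMeasure (Q 0 θ τ s t x) ν) : μ = ν := by
  have := hμ.isProbabilityMeasure
  have := hν.isProbabilityMeasure
  exact measure_eq_of_integral_eval_eq (hμ.measure_compl_Icc hst htτ)
    (hν.measure_compl_Icc hst htτ) (integral_eval_eq_of_isOrthogonalityMeasure hμ hν)

theorem isOrthogonalityMeasure_transition (θ τ s t x : ℝ) (hst : s ≤ t) (htτ : 0 ≤ t + τ) :
    IsOrthogonalityMeasure (Q 0 θ τ s t x) (transition 0 θ τ s t x) := by
  obtain ⟨μ, hμ, -⟩ := exists_isOrthogonalityMeasure θ τ s t x hst htτ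
  have h : ∃ μ : Measure ℝ, IsOrthogonalityMeasure (Q 0 θ τ s t x) μ := ⟨μ, hμ⟩
  rw [transition, dif_pos h]
  exact h.choose_spec

/-! ### Divided differences in integral form -/

/-- The divided difference `f[x, y]` in terms of the derivative `f'`. -/
noncomputable def firstDiff (f' : ℝ → ℝ) (x y : ℝ) : ℝ :=
  ∫ s in (0 : ℝ)..1, f' (x + s * (y - x))

/-- The divided difference `f[x, y, z]` in terms of the second derivative `f''`. -/
noncomputable def secondDiff (f'' : ℝ → ℝ) (x y z : ℝ) : ℝ :=
  ∫ s in (0 : ℝ)..1, ∫ r in (0 : ℝ)..1, s * f'' (x + s * (z - x) + s * r * (y - z))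

theorem continuous_secondDiff {φ : ℝ → ℝ} (hφ : Continuous φ) (x : ℝ) :
    Continuous fun q : ℝ × ℝ => secondDiff φ x q.1 q.2 := by
  unfold secondDiff
  refine intervalIntegral.continuous_parametric_intervalIntegral_of_continuous' ?_ _ _
  refine intervalIntegral.continuous_parametric_intervalIntegral_of_continuous' (f :=
    fun (w : (ℝ × ℝ) × ℝ) (r : ℝ) =>
      w.2 * φ (x + w.2 * (w.1.2 - x) + w.2 * r * (w.1.1 - w.1.2))) ?_ _ _
  unfold Function.uncurry
  fun_prop

theorem continuous_secondDiff_inner {φ : ℝ → ℝ} (hφ : Continuous φ) (x y z : ℝ) :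
    Continuous fun s : ℝ =>
      ∫ r in (0 : ℝ)..1, s * φ (x + s * (z - x) + s * r * (y - z)) := by
  refine intervalIntegral.continuous_parametric_intervalIntegral_of_continuous' ?_ _ _
  unfold Function.uncurry
  fun_prop

/-- The argument of `φ` is a convex combination of the three nodes. The weight `s ≤ 1` is simply
dropped, so the bound is twice the sharp one. -/
theorem abs_secondDiff_le {φ : ℝ → ℝ} {x y z C : ℝ} {K : Set ℝ} (hK : Convex ℝ K)
    (hx : x ∈ K) (hy : y ∈ K) (hz : z ∈ K) (h : ∀ u ∈ K, |φ u| ≤ C) :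
    |secondDiff φ x y z| ≤ C := by
  have key : ∀ s ∈ uIoc (0 : ℝ) 1,
      ‖∫ r in (0 : ℝ)..1, s * φ (x + s * (z - x) + s * r * (y - z))‖ ≤ C := fun s hs => by
    rw [uIoc_of_le zero_le_one] at hs
    have := intervalIntegral.norm_integral_le_of_norm_le_const (a := 0) (b := 1)
      (f := fun r => s * φ (x + s * (z - x) + s * r * (y - z))) (C := C) (fun r hr => by
        rw [uIoc_of_le zero_le_one] at hr
        have hm : z + r * (y - z) ∈ K := by
          have := hK hz hy (sub_nonneg.mpr hr.2) hr.1.le (by ring)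
          simp only [smul_eq_mul] at this
          convert this using 1
          ring
        have hm' : x + s * (z - x) + s * r * (y - z) ∈ K := by
          have := hK hx hm (sub_nonneg.mpr hs.2) hs.1.le (by ring)
          simp only [smul_eq_mul] at this
          convert this using 1
          ring
        rw [norm_mul, Real.norm_eq_abs, Real.norm_eq_abs, abs_of_pos hs.1]
        have h0 := h _ hm'
        exact (mul_le_of_le_one_left (abs_nonneg _) hs.2).trans h0)
    simpa using this
  simpa [secondDiff] using
    intervalIntegral.norm_integral_le_of_norm_le_const key

theorem secondDiff_sub {φ ψ : ℝ → ℝ} (hφ : Continuous φ) (hψ : Continuous ψ) (x y z : ℝ) :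
    secondDiff (fun u => φ u - ψ u) x y z = secondDiff φ x y z - secondDiff ψ x y z := by
  unfold secondDiff
  rw [← intervalIntegral.integral_sub
    ((continuous_secondDiff_inner hφ x y z).intervalIntegrable _ _)
    ((continuous_secondDiff_inner hψ x y z).intervalIntegrable _ _)]
  refine intervalIntegral.integral_congr fun s _ => ?_
  simp only [mul_sub]
  refine intervalIntegral.integral_sub ?_ ?_ <;>
    exact Continuous.intervalIntegrable (by fun_prop) _ _

theorem firstDiff_self (f' : ℝ → ℝ) (x : ℝ) : firstDiff f' x x = f' x := by
  simp [firstDiff]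

theorem sub_mul_firstDiff {f f' : ℝ → ℝ} (hf : ∀ u, HasDerivAt f (f' u) u)
    (hf' : Continuous f') (x y : ℝ) : (y - x) * firstDiff f' x y = f y - f x := by
  rw [firstDiff, ← intervalIntegral.integral_const_mul]
  have h : ∀ s ∈ uIcc (0 : ℝ) 1,
      HasDerivAt (fun s => f (x + s * (y - x))) ((y - x) * f' (x + s * (y - x))) s := fun s _ => by
    have h1 : HasDerivAt (fun s : ℝ => x + s * (y - x)) (y - x) s := by
      simpa using ((hasDerivAt_id s).mul_const (y - x)).const_add x
    rw [mul_comm]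
    exact (hf _).comp s h1
  rw [intervalIntegral.integral_eq_sub_of_hasDerivAt h
    (Continuous.intervalIntegrable (by fun_prop) _ _)]
  congr 2 <;> ring

/-- The inner integral is evaluated by the fundamental theorem of calculus in `r`. The product form
stays valid when nodes coincide. -/
theorem sub_mul_secondDiff {f' f'' : ℝ → ℝ} (hf : ∀ u, HasDerivAt f' (f'' u) u)
    (hf'' : Continuous f'') (x y z : ℝ) :
    (y - z) * secondDiff f'' x y z = firstDiff f' x y - firstDiff f' x z := by
  have hc : Continuous f' := continuous_iff_continuousAt.mpr fun u => (hf u).continuousAt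
  rw [secondDiff, ← intervalIntegral.integral_const_mul, firstDiff, firstDiff,
    ← intervalIntegral.integral_sub (Continuous.intervalIntegrable (by fun_prop) _ _)
      (Continuous.intervalIntegrable (by fun_prop) _ _)]
  refine intervalIntegral.integral_congr fun s _ => ?_
  rw [← intervalIntegral.integral_const_mul]
  have h : ∀ r ∈ uIcc (0 : ℝ) 1,
      HasDerivAt (fun r => f' (x + s * (z - x) + s * r * (y - z)))
        ((y - z) * (s * f'' (x + s * (z - x) + s * r * (y - z)))) r := fun r _ => by
    have h1 : HasDerivAt (fun r : ℝ => x + s * (z - x) + s * r * (y - z)) (s * (y - z)) r := by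
      simpa using (((hasDerivAt_id r).const_mul s).mul_const (y - z)).const_add (x + s * (z - x))
    exact ((hf _).comp r h1).congr_deriv (by ring)
  rw [intervalIntegral.integral_eq_sub_of_hasDerivAt h
    (Continuous.intervalIntegrable (by fun_prop) _ _)]
  congr 2 <;> ring

/-- By the quotient rule the derivative is `(f y - f x - f' x * (y - x)) / (y - x) ^ 2`. The
diagonal is excluded because division by zero there takes a default value. -/
theorem diffQuotDeriv_eq_secondDiff {f f' f'' : ℝ → ℝ} (hf : ∀ u, HasDerivAt f (f' u) u)
    (hf' : ∀ u, HasDerivAt f' (f'' u) u) (hf'' : Continuous f'') {x y : ℝ} (hxy : y ≠ x) :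
    diffQuotDeriv f x y = secondDiff f'' x x y := by
  have hc : Continuous f' := continuous_iff_continuousAt.mpr fun u => (hf' u).continuousAt
  have h1 := sub_mul_firstDiff hf hc x y
  have h2 := sub_mul_secondDiff hf' hf'' x x y
  rw [firstDiff_self] at h2
  have hne : y - x ≠ 0 := sub_ne_zero.mpr hxy
  have hd : HasDerivAt (fun z => (f y - f z) / (y - z))
      ((-f' x * (y - x) - (f y - f x) * -1) / (y - x) ^ 2) x :=
    ((hf x).const_sub (f y)).fun_div ((hasDerivAt_id x).const_sub y) hne
  rw [diffQuotDeriv, hd.deriv, div_eq_iff (pow_ne_zero 2 hne)]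
  linear_combination -h1 + (y - x) * h2

/-! ### The semicircle law -/

theorem integral_semicircle (m : ℝ) {v : ℝ} (hv : 0 < v) (f : ℝ → ℝ) :
    ∫ y, f y ∂(semicircle m v)
      = 2 / Real.pi * ∫ φ in (0 : ℝ)..Real.pi, Real.sin φ ^ 2 * f (m + 2 * √v * Real.cos φ) := by
  have hsv : 0 < √v := Real.sqrt_pos.mpr hv
  have hsq : √v * √v = v := Real.mul_self_sqrt hv.le
  have h1 : ∫ y, f y ∂(semicircle m v) = ∫ y, √(4 * v - (y - m) ^ 2) / (2 * Real.pi * v) * f y := by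
    rw [semicircle, integral_withDensity_eq_integral_toReal_smul (by fun_prop)
      (ae_of_all _ fun _ => ENNReal.ofReal_lt_top)]
    refine integral_congr_ae (ae_of_all _ fun y => ?_)
    simp only [smul_eq_mul]
    rw [ENNReal.toReal_ofReal (by positivity)]
  have h2 : ∫ y, √(4 * v - (y - m) ^ 2) / (2 * Real.pi * v) * f y
      = 2 / Real.pi * ∫ u, √(1 - u ^ 2) * f (m + 2 * √v * u) := by
    rw [← integral_add_left_eq_self _ m]
    have h := Measure.integral_comp_mul_left
      (fun y => √(4 * v - (m + y - m) ^ 2) / (2 * Real.pi * v) * f (m + y)) (2 * √v)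
    rw [abs_of_pos (by positivity), smul_eq_mul, eq_comm, inv_mul_eq_iff_eq_mul₀ (by positivity)]
      at h
    rw [h, ← integral_const_mul, ← integral_const_mul]
    refine integral_congr_ae (ae_of_all _ fun u => ?_)
    have hs : √(4 * v - (m + 2 * √v * u - m) ^ 2) = 2 * √v * √(1 - u ^ 2) := by
      rw [show 4 * v - (m + 2 * √v * u - m) ^ 2 = (2 * √v) ^ 2 * (1 - u ^ 2) by
        linear_combination (4 * u ^ 2 - 4) * hsq - 8 * u ^ 2 * hsq + 4 * u ^ 2 * hsq,
        Real.sqrt_mul (sq_nonneg _), Real.sqrt_sq (by positivity)]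
    simp only [hs]
    generalize f (m + 2 * √v * u) = w
    have hpi := Real.pi_ne_zero
    field_simp
    linear_combination (√(1 - u ^ 2) * w) * hsq
  have h3 : ∫ u, √(1 - u ^ 2) * f (m + 2 * √v * u)
      = ∫ u in (-1 : ℝ)..1, (1 - u ^ 2) * f (m + 2 * √v * u) * √(1 - u ^ 2)⁻¹ := by
    rw [intervalIntegral.integral_of_le (by norm_num), ← setIntegral_eq_integral_of_forall_compl_eq_zero
      (s := Ioc (-1 : ℝ) 1)]
    · refine setIntegral_congr_fun measurableSet_Ioc fun u hu => ?_
      have h0 : 0 ≤ 1 - u ^ 2 := by nlinarith [hu.1, hu.2]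
      rw [Real.sqrt_inv, mul_right_comm (1 - u ^ 2), ← div_eq_mul_inv, Real.div_sqrt]
    · intro u hu
      rw [Real.sqrt_eq_zero_of_nonpos, zero_mul]
      by_contra hcon
      have habs := abs_lt.mp ((sq_lt_one_iff_abs_lt_one u).mp (by linarith))
      exact hu ⟨habs.1, habs.2.le⟩
  -- The factor `√(1 - u²)` was split as `(1 - u²) / √(1 - u²)` to reach the arcsine weight, for
  -- which `u = cos φ` gives a plain integral over `[0, π]`.
  rw [h1, h2, h3, ← Polynomial.Chebyshev.integral_measureT
    (fun u => (1 - u ^ 2) * f (m + 2 * √v * u)),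
    Polynomial.Chebyshev.integral_measureT_eq_integral_cos]
  simp only [Real.sin_sq]

theorem isProbabilityMeasure_semicircle (m : ℝ) {v : ℝ} (hv : 0 < v) :
    IsProbabilityMeasure (semicircle m v) := by
  have h := integral_semicircle m hv (fun _ => 1)
  simp only [mul_one, integral_sin_sq, integral_const, smul_eq_mul] at h
  have h1 : (semicircle m v).real univ = 1 := by
    rw [h]
    simp
  refine ⟨?_⟩
  rwa [measureReal_def, ENNReal.toReal_eq_one_iff] at h1

theorem semicircle_compl_Ioo (m v : ℝ) (hv : 0 < v) :
    semicircle m v (Ioo (m - 2 * √v) (m + 2 * √v))ᶜ = 0 := by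
  rw [semicircle, withDensity_apply _ measurableSet_Ioo.compl]
  refine (setLIntegral_congr_fun measurableSet_Ioo.compl fun y hy => ?_).trans lintegral_zero
  have hsq : √v ^ 2 = v := Real.sq_sqrt hv.le
  rw [Real.sqrt_eq_zero_of_nonpos, zero_div, ENNReal.ofReal_zero]
  by_contra hcon
  have h2 : |y - m| < 2 * √v := abs_lt_of_sq_lt_sq (by rw [mul_pow, hsq]; linarith) (by positivity)
  rw [abs_lt] at h2
  exact hy ⟨by linarith, by linarith⟩

theorem semicircle_compl_Icc (m v : ℝ) (hv : 0 < v) :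
    semicircle m v (Icc (m - 2 * √v) (m + 2 * √v))ᶜ = 0 :=
  measure_mono_null (compl_subset_compl.mpr Ioo_subset_Icc_self) (semicircle_compl_Ioo m v hv)

theorem integral_cos_nat_mul_zero_pi {k : ℕ} (hk : k ≠ 0) :
    ∫ φ in (0 : ℝ)..Real.pi, Real.cos (k * φ) = 0 := by
  have hk' : (k : ℝ) ≠ 0 := Nat.cast_ne_zero.mpr hk
  rw [intervalIntegral.integral_comp_mul_left _ hk', integral_cos]
  simp [Real.sin_nat_mul_pi]

theorem integral_sin_mul_sin_zero_pi {n : ℕ} (hn : n ≠ 0) :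
    ∫ φ in (0 : ℝ)..Real.pi, Real.sin φ * Real.sin ((n + 1) * φ) = 0 := by
  have h : ∀ φ : ℝ, Real.sin φ * Real.sin ((n + 1) * φ)
      = (Real.cos ((n : ℕ) * φ) - Real.cos ((n + 2 : ℕ) * φ)) / 2 := fun φ => by
    rw [Real.cos_sub_cos]
    push_cast
    rw [show (n * φ + (n + 2) * φ) / 2 = (n + 1) * φ by ring,
      show (n * φ - (n + 2) * φ) / 2 = -φ by ring, Real.sin_neg]
    ring
  simp only [h]
  rw [intervalIntegral.integral_div, intervalIntegral.integral_sub
    (Continuous.intervalIntegrable (by fun_prop) _ _)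
    (Continuous.intervalIntegrable (by fun_prop) _ _),
    integral_cos_nat_mul_zero_pi hn, integral_cos_nat_mul_zero_pi (by omega)]
  simp

theorem integral_id_semicircle (m : ℝ) {v : ℝ} (hv : 0 < v) :
    ∫ y, y ∂(semicircle m v) = m := by
  rw [integral_semicircle m hv]
  have h : ∀ φ : ℝ, Real.sin φ ^ 2 * (m + 2 * √v * Real.cos φ)
      = m * Real.sin φ ^ 2 + √v * (Real.sin φ * Real.sin ((1 + 1) * φ)) := fun φ => by
    rw [show (1 + 1) * φ = 2 * φ by ring, Real.sin_two_mul]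
    ring
  have h1 := integral_sin_mul_sin_zero_pi one_ne_zero
  rw [Nat.cast_one] at h1
  simp only [h]
  rw [intervalIntegral.integral_add (Continuous.intervalIntegrable (by fun_prop) _ _)
    (Continuous.intervalIntegrable (by fun_prop) _ _), intervalIntegral.integral_const_mul,
    intervalIntegral.integral_const_mul, h1, integral_sin_sq]
  simp
  field_simp

theorem integral_sub_sq_semicircle (m : ℝ) {v : ℝ} (hv : 0 < v) :
    ∫ y, (y - m) ^ 2 ∂(semicircle m v) = v := by
  rw [integral_semicircle m hv]
  have h : ∀ φ : ℝ, Real.sin φ ^ 2 * (m + 2 * √v * Real.cos φ - m) ^ 2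
      = 4 * v * (Real.sin φ ^ 2 * Real.cos φ ^ 2) := fun φ => by
    linear_combination 4 * Real.sin φ ^ 2 * Real.cos φ ^ 2 * Real.sq_sqrt hv.le
  simp only [h]
  rw [intervalIntegral.integral_const_mul, integral_sin_sq_mul_cos_sq]
  have h4 : Real.sin (4 * Real.pi) = 0 := by exact_mod_cast Real.sin_nat_mul_pi 4
  rw [h4]
  simp
  field_simp
  norm_num

/-! ### Rescaled Chebyshev polynomials and their associated polynomials -/

/-- The monic orthogonal polynomials of the semicircle law with mean `m` and variance `v`. -/
noncomputable def semicirclePoly (m v : ℝ) : ℕ → ℝ[X]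
  | 0 => 1
  | 1 => Polynomial.X - Polynomial.C m
  | n + 2 => (Polynomial.X - Polynomial.C m) * semicirclePoly m v (n + 1)
      - Polynomial.C v * semicirclePoly m v n

/-- These are Chebyshev polynomials of the second kind, rescaled to the support; the recurrence
becomes the addition formula for the sine. -/
theorem semicirclePoly_eval_mul_sin (m : ℝ) {v : ℝ} (hv : 0 ≤ v) (φ : ℝ) (n : ℕ) :
    (semicirclePoly m v n).eval (m + 2 * √v * Real.cos φ) * Real.sin φ
      = √v ^ n * Real.sin ((n + 1) * φ) := by
  induction n using Nat.strong_induction_on with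
  | _ n ih =>
    match n with
    | 0 => simp [semicirclePoly]
    | 1 =>
      simp only [semicirclePoly, Polynomial.eval_sub, Polynomial.eval_X, Polynomial.eval_C]
      push_cast
      rw [show (1 + 1) * φ = 2 * φ by ring, Real.sin_two_mul]
      ring
    | n + 2 =>
      have h1 := ih (n + 1) (by omega)
      have h0 := ih n (by omega)
      simp only [semicirclePoly, Polynomial.eval_sub, Polynomial.eval_mul, Polynomial.eval_X,
        Polynomial.eval_C]
      push_cast at h1 ⊢
      rw [show (n + 2 + 1) * φ = (n + 1 + 1) * φ + φ by ring, Real.sin_add]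
      rw [show (n + 1) * φ = (n + 1 + 1) * φ - φ by ring, Real.sin_sub] at h0
      linear_combination 2 * √v * Real.cos φ * h1 - v * h0
        + √v ^ n * (Real.sin ((n + 1 + 1) * φ) * Real.cos φ
          - Real.cos ((n + 1 + 1) * φ) * Real.sin φ) * Real.sq_sqrt hv

theorem integral_semicirclePoly_succ (m : ℝ) {v : ℝ} (hv : 0 < v) (n : ℕ) :
    ∫ y, (semicirclePoly m v (n + 1)).eval y ∂(semicircle m v) = 0 := by
  rw [integral_semicircle m hv]
  have h : ∀ φ : ℝ, Real.sin φ ^ 2 * (semicirclePoly m v (n + 1)).eval (m + 2 * √v * Real.cos φ)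
      = √v ^ (n + 1) * (Real.sin φ * Real.sin (((n + 1 : ℕ) + 1) * φ)) := fun φ => by
    linear_combination Real.sin φ * semicirclePoly_eval_mul_sin m hv.le φ (n + 1)
  simp only [h]
  rw [intervalIntegral.integral_const_mul, integral_sin_mul_sin_zero_pi (Nat.succ_ne_zero n),
    mul_zero, mul_zero]

theorem span_range_semicirclePoly (m v : ℝ) :
    Submodule.span ℝ (range (semicirclePoly m v)) = ⊤ := by
  set W := Submodule.span ℝ (range (semicirclePoly m v)) with hW
  have hmem : ∀ n, semicirclePoly m v n ∈ W := fun n => Submodule.subset_span ⟨n, rfl⟩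
  refine Polynomial.submodule_eq_top_of_X_mul_mem (hmem 0) fun p hp => ?_
  induction hp using Submodule.span_induction with
  | mem p hp =>
    obtain ⟨n, rfl⟩ := hp
    match n with
    | 0 =>
      have : Polynomial.X * semicirclePoly m v 0
          = semicirclePoly m v 1 + m • semicirclePoly m v 0 := by
        simp only [semicirclePoly, Polynomial.smul_eq_C_mul]
        ring
      rw [this]
      exact W.add_mem (hmem 1) (W.smul_mem _ (hmem 0))
    | n + 1 =>
      have : Polynomial.X * semicirclePoly m v (n + 1)
          = semicirclePoly m v (n + 2) + m • semicirclePoly m v (n + 1)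
            + v • semicirclePoly m v n := by
        simp only [semicirclePoly, Polynomial.smul_eq_C_mul]
        ring
      rw [this]
      exact W.add_mem (W.add_mem (hmem _) (W.smul_mem _ (hmem _))) (W.smul_mem _ (hmem _))
  | zero => simp
  | add p q _ _ hp hq => rw [mul_add]; exact W.add_mem hp hq
  | smul c p _ hp => rw [mul_smul_comm]; exact W.smul_mem _ hp

/-- Expansion of the Jacobi determinant along its first row: the minors belong to the semicircle
law. This is where `s` and `x` separate from `θ` and `t + τ`. -/
theorem Q_zero_succ_eq_semicirclePoly (θ τ s t x : ℝ) (n : ℕ) :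
    Q 0 θ τ s t x (n + 2) = (Polynomial.X - Polynomial.C x) * semicirclePoly θ (t + τ) (n + 1)
      - Polynomial.C (t - s) * semicirclePoly θ (t + τ) n := by
  induction n using Nat.strong_induction_on with
  | _ n ih =>
    match n with
    | 0 =>
      simp only [zero_add, Q_zero_two, Q_zero_one, semicirclePoly]
      ring
    -- `Q 3` needs its own check, since its recurrence involves `Q 1`, which the formula does not
    -- cover.
    | 1 =>
      have h0 := ih 0 one_pos
      simp only [zero_add] at h0
      simp only [Nat.reduceAdd, Q_zero_add_three θ τ s t x 0, zero_add, h0, Q_zero_one,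
        semicirclePoly]
      ring
    | n + 2 =>
      have h1 := ih (n + 1) (by omega)
      have h0 := ih n (by omega)
      rw [Q_zero_add_three θ τ s t x (n + 1), h1, h0]
      simp only [semicirclePoly]
      ring

/-- The associated polynomial `y ↦ ∫ (p(y) - p(z)) / (y - z) w(dz)`. -/
noncomputable def associatedEval (w : Measure ℝ) (p : ℝ[X]) (y : ℝ) : ℝ :=
  ∫ z, (p.eval y - p.eval z) / (y - z) ∂w

/-- Difference quotients take the default value `0` on the diagonal; an atomless measure does not
see it. -/
theorem ae_ne_of_nullSingletonClass (w : Measure ℝ) [NullSingletonClass w] (y : ℝ) :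
    ∀ᵐ z ∂w, z ≠ y := by
  simp [ae_iff]

section Associated

variable {w : Measure ℝ} [IsFiniteMeasure w] [NullSingletonClass w] {a b : ℝ}

/-- By the factor theorem the quotient is a polynomial in `z` off the diagonal, hence bounded on the
support. -/
theorem integrable_divided_difference (hw : w (Icc a b)ᶜ = 0) (p : ℝ[X]) (y : ℝ) :
    Integrable (fun z => (p.eval y - p.eval z) / (y - z)) w := by
  obtain ⟨q, hq⟩ := Polynomial.X_sub_C_dvd_sub_C_eval (a := y) (p := p)
  refine (q.continuous.integrable_of_measure_compl_Icc_eq_zero hw).congr ?_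
  filter_upwards [ae_ne_of_nullSingletonClass w y] with z hz
  have h := congrArg (Polynomial.eval z) hq
  simp only [Polynomial.eval_sub, Polynomial.eval_C, Polynomial.eval_mul, Polynomial.eval_X] at h
  rw [eq_div_iff (sub_ne_zero.mpr hz.symm)]
  linear_combination h

theorem associatedEval_add (hw : w (Icc a b)ᶜ = 0) (p q : ℝ[X]) (y : ℝ) :
    associatedEval w (p + q) y = associatedEval w p y + associatedEval w q y := by
  rw [associatedEval, associatedEval, associatedEval, ← integral_add
    (integrable_divided_difference hw p y) (integrable_divided_difference hw q y)]
  congr 1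
  ext z
  rw [Polynomial.eval_add, Polynomial.eval_add]
  ring

theorem associatedEval_C_mul (w : Measure ℝ) (c : ℝ) (p : ℝ[X]) (y : ℝ) :
    associatedEval w (Polynomial.C c * p) y = c * associatedEval w p y := by
  rw [associatedEval, associatedEval, ← integral_const_mul]
  congr 1
  ext z
  rw [Polynomial.eval_mul, Polynomial.eval_mul, Polynomial.eval_C, Polynomial.eval_C]
  ring

/-- Leibniz rule: the divided difference of `u p(u)` at `y, z` is `y p[y, z] + p(z)`. -/
theorem associatedEval_X_mul (hw : w (Icc a b)ᶜ = 0) (p : ℝ[X]) (y : ℝ) :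
    associatedEval w (Polynomial.X * p) y = y * associatedEval w p y + ∫ z, p.eval z ∂w := by
  rw [associatedEval, associatedEval, ← integral_const_mul, ← integral_add
    ((integrable_divided_difference hw p y).const_mul y)
    (p.continuous.integrable_of_measure_compl_Icc_eq_zero hw)]
  refine integral_congr_ae ?_
  filter_upwards [ae_ne_of_nullSingletonClass w y] with z hz
  have hne := sub_ne_zero.mpr hz.symm
  simp only [Polynomial.eval_mul, Polynomial.eval_X]
  field_simp
  ring

end Associated

theorem nullSingletonClass_semicircle (m v : ℝ) : NullSingletonClass (semicircle m v) :=
  ⟨fun y => withDensity_absolutelyContinuous _ _ (measure_singleton y)⟩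

theorem associatedEval_semicirclePoly_zero (w : Measure ℝ) (m v y : ℝ) :
    associatedEval w (semicirclePoly m v 0) y = 0 := by
  simp [associatedEval, semicirclePoly]

/-- Associated polynomials obey the original recurrence with shifted coefficients. Here the
coefficients are constant, so the shift only lowers the index; the extra terms from the Leibniz rule
vanish because the polynomials of positive degree have mean zero. -/
theorem associatedEval_semicirclePoly_succ (m : ℝ) {v : ℝ} (hv : 0 < v) (y : ℝ) (n : ℕ) :
    associatedEval (semicircle m v) (semicirclePoly m v (n + 1)) y
      = (semicirclePoly m v n).eval y := by
  have := isProbabilityMeasure_semicircle m hv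
  have := nullSingletonClass_semicircle m v
  have hw := semicircle_compl_Icc m v hv
  have hX : ∀ p q : ℝ[X], ∀ c d : ℝ, associatedEval (semicircle m v)
      ((Polynomial.X - Polynomial.C c) * p - Polynomial.C d * q) y
      = (y - c) * associatedEval (semicircle m v) p y + ∫ z, p.eval z ∂(semicircle m v)
        - d * associatedEval (semicircle m v) q y := fun p q c d => by
    rw [show (Polynomial.X - Polynomial.C c) * p - Polynomial.C d * q
      = Polynomial.X * p + (Polynomial.C (-c) * p + Polynomial.C (-d) * q) by
        simp only [Polynomial.C_neg]; ring,
      associatedEval_add hw, associatedEval_add hw, associatedEval_X_mul hw,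
      associatedEval_C_mul, associatedEval_C_mul]
    ring
  induction n using Nat.strong_induction_on with
  | _ n ih =>
    match n with
    | 0 =>
      have h := hX 1 0 m 0
      simpa [semicirclePoly, associatedEval] using h
    | 1 =>
      have h0 := ih 0 one_pos
      rw [show semicirclePoly m v (1 + 1) = (Polynomial.X - Polynomial.C m)
        * semicirclePoly m v (0 + 1) - Polynomial.C v * semicirclePoly m v 0 from rfl, hX, h0,
        integral_semicirclePoly_succ m hv, associatedEval_semicirclePoly_zero]
      simp [semicirclePoly]
    | n + 2 =>
      have h1 := ih (n + 1) (by omega)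
      have h0 := ih n (by omega)
      rw [show semicirclePoly m v (n + 2 + 1) = (Polynomial.X - Polynomial.C m)
        * semicirclePoly m v (n + 1 + 1) - Polynomial.C v * semicirclePoly m v (n + 1) from rfl,
        hX, h1, h0, integral_semicirclePoly_succ m hv]
      simp [semicirclePoly]

/-! ### The exact formula for the transition operator -/

/-- The integral form of `1 / G(z) = z - x - (t - s) G_w(z)` for the Cauchy transforms `G` of the
orthogonality measure and `G_w` of the semicircle law. -/
theorem integral_sub_mul_eval_eq {θ τ s t x : ℝ} (htτ : 0 < t + τ) {μ : Measure ℝ}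
    (hμ : IsOrthogonalityMeasure (Q 0 θ τ s t x) μ) (p : ℝ[X]) :
    ∫ y, (y - x) * p.eval y ∂μ
      = (t - s) * ∫ y, associatedEval (semicircle θ (t + τ)) p y ∂μ := by
  have := hμ.isProbabilityMeasure
  have := isProbabilityMeasure_semicircle θ htτ
  have := nullSingletonClass_semicircle θ (t + τ)
  have hw := semicircle_compl_Icc θ (t + τ) htτ
  have iμ := integrable_eval_of_integrable_pow hμ.integrable_pow
  have iμ' : ∀ p : ℝ[X], Integrable (fun y => (y - x) * p.eval y) μ := fun p =>
    (iμ ((Polynomial.X - Polynomial.C x) * p)).congr (ae_of_all _ fun y => by simp)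
  -- Carrying a polynomial `r` that represents the associated function makes it integrable under
  -- `μ`, as additivity over the span requires.
  suffices h : ∃ r : ℝ[X], (∀ y, associatedEval (semicircle θ (t + τ)) p y = r.eval y) ∧
      ∫ y, (y - x) * p.eval y ∂μ = (t - s) * ∫ y, r.eval y ∂μ by
    obtain ⟨r, h1, h2⟩ := h
    simp only [h1, h2]
  have hp : p ∈ Submodule.span ℝ (range (semicirclePoly θ (t + τ))) := by
    simp [span_range_semicirclePoly]
  induction hp using Submodule.span_induction with
  | mem p hp =>
    obtain ⟨_ | n, rfl⟩ := hp
    · refine ⟨0, fun y => by simp [associatedEval_semicirclePoly_zero], ?_⟩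
      simpa [semicirclePoly, Q] using hμ.integral_Q_succ 0
    · refine ⟨_, fun y => associatedEval_semicirclePoly_succ θ htτ y n, ?_⟩
      have h := hμ.integral_Q_succ (n + 1)
      simp only [Q_zero_succ_eq_semicirclePoly, Polynomial.eval_sub, Polynomial.eval_mul,
        Polynomial.eval_X, Polynomial.eval_C] at h
      rw [integral_sub (iμ' _) ((iμ _).const_mul _), integral_const_mul] at h
      linarith
  | zero => exact ⟨0, fun y => by simp [associatedEval], by simp⟩
  | add p q _ _ hp hq =>
    obtain ⟨r, hr, hr'⟩ := hp
    obtain ⟨r', hq, hq'⟩ := hq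
    refine ⟨r + r', fun y => by rw [associatedEval_add hw, hr, hq, Polynomial.eval_add], ?_⟩
    simp only [Polynomial.eval_add, mul_add]
    rw [integral_add (iμ' _) (iμ' _), integral_add (iμ _) (iμ _), hr', hq', mul_add]
  | smul c p _ hp =>
    obtain ⟨r, hr, hr'⟩ := hp
    refine ⟨Polynomial.C c * r, fun y => by
      rw [Polynomial.smul_eq_C_mul, associatedEval_C_mul, hr, Polynomial.eval_mul,
        Polynomial.eval_C], ?_⟩
    simp only [Polynomial.eval_smul, smul_eq_mul, Polynomial.eval_mul, Polynomial.eval_C,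
      mul_left_comm _ c]
    rw [integral_const_mul, integral_const_mul, hr', mul_left_comm]

/-- With `p(y) - p(x) = (y - x) g(y)`, the previous identity applies to `g = p[x, ·]`, and `g[y, z]
= p[x, y, z]`. -/
theorem integral_eval_sub_eq {θ τ s t x : ℝ} (htτ : 0 < t + τ) {μ : Measure ℝ}
    (hμ : IsOrthogonalityMeasure (Q 0 θ τ s t x) μ) (p : ℝ[X]) :
    ∫ y, p.eval y ∂μ - p.eval x = (t - s) * ∫ y, ∫ z,
      secondDiff (fun u => p.derivative.derivative.eval u) x y z ∂(semicircle θ (t + τ)) ∂μ := by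
  have := hμ.isProbabilityMeasure
  have := nullSingletonClass_semicircle θ (t + τ)
  have iμ := integrable_eval_of_integrable_pow hμ.integrable_pow
  obtain ⟨g, hg⟩ := Polynomial.X_sub_C_dvd_sub_C_eval (a := x) (p := p)
  have hg' : ∀ y, p.eval y - p.eval x = (y - x) * g.eval y := fun y => by
    simpa using congrArg (Polynomial.eval y) hg
  have hfirst : ∀ y, firstDiff (fun u => p.derivative.eval u) x y = g.eval y := fun y => by
    by_cases hy : y = x
    · subst hy
      rw [firstDiff_self]
      simpa using congrArg (Polynomial.eval y) (congrArg Polynomial.derivative hg)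
    · refine mul_left_cancel₀ (sub_ne_zero.mpr hy) ?_
      rw [sub_mul_firstDiff (fun u => p.hasDerivAt u) p.derivative.continuous, hg']
  have h1 : ∫ y, p.eval y ∂μ - p.eval x = ∫ y, (y - x) * g.eval y ∂μ := by
    simp only [← hg']
    rw [integral_sub (iμ p) (integrable_const _)]
    simp
  rw [h1, integral_sub_mul_eval_eq htτ hμ]
  congr 2
  ext y
  refine integral_congr_ae ?_
  filter_upwards [ae_ne_of_nullSingletonClass (semicircle θ (t + τ)) y] with z hz
  rw [div_eq_iff (sub_ne_zero.mpr hz.symm), mul_comm, sub_mul_secondDiff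
    (fun u => p.derivative.hasDerivAt u) p.derivative.derivative.continuous, hfirst, hfirst]

theorem Polynomial.exists_derivative_eq (q : ℝ[X]) : ∃ p : ℝ[X], p.derivative = q := by
  induction q using Polynomial.induction_on' with
  | add p q hp hq =>
    obtain ⟨P, hP⟩ := hp
    obtain ⟨R, hR⟩ := hq
    exact ⟨P + R, by rw [Polynomial.derivative_add, hP, hR]⟩
  | monomial n c =>
    refine ⟨Polynomial.monomial (n + 1) (c / (n + 1)), ?_⟩
    rw [Polynomial.derivative_monomial]
    have : (n : ℝ) + 1 ≠ 0 := by positivity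
    simp [this]

theorem Polynomial.exists_derivative_eq_eval_eq (q : ℝ[X]) (x c : ℝ) :
    ∃ p : ℝ[X], p.derivative = q ∧ p.eval x = c := by
  obtain ⟨p, hp⟩ := q.exists_derivative_eq
  exact ⟨p + Polynomial.C (c - p.eval x), by simp [hp], by simp⟩

theorem eq_sub_sq_mul_secondDiff {f f' f'' : ℝ → ℝ} (hf : ∀ u, HasDerivAt f (f' u) u)
    (hf' : ∀ u, HasDerivAt f' (f'' u) u) (hf'' : Continuous f'') (x y : ℝ) :
    f y - f x - f' x * (y - x) = (y - x) ^ 2 * secondDiff f'' x y x := by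
  have hc : Continuous f' := continuous_iff_continuousAt.mpr fun u => (hf' u).continuousAt
  have h1 := sub_mul_firstDiff hf hc x y
  have h2 := sub_mul_secondDiff hf' hf'' x y x
  rw [firstDiff_self] at h2
  linear_combination -h1 - (y - x) * h2

/-- The mean of `z ↦ F (y, z)` under the semicircle law of variance `v`, as a function of `(v, y)`. -/
noncomputable def semicircleMean (m : ℝ) (F : ℝ × ℝ → ℝ) (q : ℝ × ℝ) : ℝ :=
  2 / Real.pi * ∫ φ in (0 : ℝ)..Real.pi,
    Real.sin φ ^ 2 * F (q.2, m + 2 * √q.1 * Real.cos φ)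

/-- In the angular form the variance enters only through the integrand, over a fixed interval. This
gives joint continuity in the variance and the point. -/
theorem continuous_semicircleMean (m : ℝ) {F : ℝ × ℝ → ℝ} (hF : Continuous F) :
    Continuous (semicircleMean m F) := by
  unfold semicircleMean
  refine continuous_const.mul
    (intervalIntegral.continuous_parametric_intervalIntegral_of_continuous' ?_ _ _)
  unfold Function.uncurry
  fun_prop

theorem integral_semicircle_eq_semicircleMean (m : ℝ) {v : ℝ} (hv : 0 < v) (F : ℝ × ℝ → ℝ)
    (y : ℝ) : ∫ z, F (y, z) ∂(semicircle m v) = semicircleMean m F (v, y) :=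
  integral_semicircle m hv fun z => F (y, z)

theorem integral_sub_eq_semicircleMean {θ τ s t x : ℝ} (hst : s ≤ t) (htτ : 0 < t + τ)
    {μ : Measure ℝ} (hμ : IsOrthogonalityMeasure (Q 0 θ τ s t x) μ) {f f' f'' : ℝ → ℝ}
    (hf : ∀ u, HasDerivAt f (f' u) u) (hf' : ∀ u, HasDerivAt f' (f'' u) u)
    (hf'' : Continuous f'') :
    ∫ y, f y ∂μ - f x = (t - s) *
      ∫ y, semicircleMean θ (fun q => secondDiff f'' x q.1 q.2) (t + τ, y) ∂μ := by
  have := hμ.isProbabilityMeasure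
  have := isProbabilityMeasure_semicircle θ htτ
  have hfc : Continuous f := continuous_iff_continuousAt.mpr fun u => (hf u).continuousAt
  set v := t + τ with hv
  -- One interval holding `x` and the supports of both measures.
  set M := max |x| (max (supportBound θ τ s t x) (|θ| + 2 * √v)) with hM
  have hM0 : 0 ≤ M := (abs_nonneg x).trans (le_max_left _ _)
  have hxM : x ∈ Icc (-M) M := abs_le.mp (le_max_left _ _)
  have hμM : μ (Icc (-M) M)ᶜ = 0 := by
    have h : supportBound θ τ s t x ≤ M := (le_max_left _ _).trans (le_max_right _ _)
    exact measure_mono_null (compl_subset_compl.mpr (Icc_subset_Icc (neg_le_neg h) h))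
      (hμ.measure_compl_Icc hst htτ.le)
  have hwM : semicircle θ v (Icc (-M) M)ᶜ = 0 := by
    have h : |θ| + 2 * √v ≤ M := (le_max_right _ _).trans (le_max_right _ _)
    refine measure_mono_null (compl_subset_compl.mpr (Icc_subset_Icc ?_ ?_))
      (semicircle_compl_Icc θ v htτ)
    · linarith [neg_abs_le θ]
    · linarith [le_abs_self θ]
  have hcont : ∀ φ : ℝ → ℝ, Continuous φ → Continuous fun y =>
      semicircleMean θ (fun q => secondDiff φ x q.1 q.2) (v, y) := fun φ hφ =>
    (continuous_semicircleMean θ (continuous_secondDiff hφ x)).comp (by fun_prop)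
  have key : ∀ ε : ℝ, 0 < ε → |(∫ y, f y ∂μ - f x) - (t - s) *
      ∫ y, semicircleMean θ (fun q => secondDiff f'' x q.1 q.2) (v, y) ∂μ|
      ≤ ((2 * M) ^ 2 + (t - s)) * ε := fun ε hε => by
    obtain ⟨q, hq⟩ := exists_polynomial_near_of_continuousOn (-M) M f'' hf''.continuousOn ε hε
    -- Integrating `q` twice with constants matched at `x` makes `f - p` vanish there to second
    -- order, so `|f - p| ≤ (2 * M) ^ 2 * ε` on the interval. The double integral contributes the
    -- other error, `(t - s) * ε`.
    obtain ⟨p', hp', hp'x⟩ := q.exists_derivative_eq_eval_eq x (f' x)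
    obtain ⟨p, hp, hpx⟩ := p'.exists_derivative_eq_eval_eq x (f x)
    have hid := integral_eval_sub_eq htτ hμ p
    rw [hp, hp', hpx] at hid
    have hq' : ∀ u ∈ Icc (-M) M, |f'' u - q.eval u| ≤ ε := fun u hu => by
      rw [abs_sub_comm]
      exact (hq u hu).le
    have hsd : ∀ y ∈ Icc (-M) M, ∀ z ∈ Icc (-M) M,
        |secondDiff (fun u => f'' u - q.eval u) x y z| ≤ ε := fun y hy z hz =>
      abs_secondDiff_le (convex_Icc _ _) hxM hy hz hq'
    have h1 : |∫ y, (f y - p.eval y) ∂μ| ≤ (2 * M) ^ 2 * ε := by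
      refine abs_integral_le_of_measure_compl_Icc hμM fun y hy => ?_
      have h := eq_sub_sq_mul_secondDiff (f := fun u => f u - p.eval u)
        (f' := fun u => f' u - p'.eval u) (f'' := fun u => f'' u - q.eval u)
        (fun u => (hf u).sub (hp ▸ p.hasDerivAt u)) (fun u => (hf' u).sub (hp' ▸ p'.hasDerivAt u))
        (hf''.sub q.continuous) x y
      simp only [hpx, hp'x, sub_self, zero_mul, sub_zero] at h
      rw [h, abs_mul, abs_of_nonneg (sq_nonneg _)]
      refine mul_le_mul (sq_le_sq' ?_ ?_) (hsd y hy x hxM) (abs_nonneg _) (sq_nonneg _)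
      · linarith [hy.1, hxM.2]
      · linarith [hy.2, hxM.1]
    have h2 : |∫ y, (semicircleMean θ (fun q => secondDiff f'' x q.1 q.2) (v, y)
        - ∫ z, secondDiff (fun u => q.eval u) x y z ∂(semicircle θ v)) ∂μ| ≤ ε := by
      refine abs_integral_le_of_measure_compl_Icc hμM fun y hy => ?_
      have hi : ∀ φ : ℝ → ℝ, Continuous φ →
          Integrable (fun z => secondDiff φ x y z) (semicircle θ v) := fun φ hφ =>
        ((continuous_secondDiff hφ x).comp
          (Continuous.prodMk_right y)).integrable_of_measure_compl_Icc_eq_zero hwM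
      rw [← integral_semicircle_eq_semicircleMean θ htτ, ← integral_sub (hi _ hf'')
        (hi _ q.continuous)]
      simp only [← secondDiff_sub hf'' q.continuous]
      exact abs_integral_le_of_measure_compl_Icc hwM fun z hz => hsd y hy z hz
    have hcq : Continuous fun y => ∫ z, secondDiff (fun u => q.eval u) x y z ∂(semicircle θ v) :=
      (hcont _ q.continuous).congr fun y =>
        (integral_semicircle_eq_semicircleMean θ htτ
          (fun r => secondDiff (fun u => q.eval u) x r.1 r.2) y).symm
    rw [integral_sub (hfc.integrable_of_measure_compl_Icc_eq_zero hμM)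
      (p.continuous.integrable_of_measure_compl_Icc_eq_zero hμM)] at h1
    rw [integral_sub ((hcont _ hf'').integrable_of_measure_compl_Icc_eq_zero hμM)
      (hcq.integrable_of_measure_compl_Icc_eq_zero hμM)] at h2
    have h3 := mul_le_mul_of_nonneg_left h2 (sub_nonneg.mpr hst)
    rw [← abs_of_nonneg (sub_nonneg.mpr hst), ← abs_mul, abs_of_nonneg (sub_nonneg.mpr hst),
      mul_sub, ← hid] at h3
    rw [abs_le] at h1 h3 ⊢
    constructor <;> linarith
  refine eq_of_abs_sub_nonpos (le_of_forall_pos_le_add fun δ hδ => ?_)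
  -- The summand `1` keeps the divisor positive without examining `M` or `t - s`.
  have hK : 0 < (2 * M) ^ 2 + (t - s) + 1 := by nlinarith [sq_nonneg (2 * M)]
  have h := key (δ / ((2 * M) ^ 2 + (t - s) + 1)) (div_pos hδ hK)
  rw [zero_add]
  refine h.trans ?_
  rw [mul_div_assoc', div_le_iff₀ hK]
  nlinarith

/-! ### Concentration of the transition measures -/

/-- Write `(y - x)²` in terms of `Q 2`, `Q 1` and the constant `t - s`; the first two integrate to
zero. -/
theorem QMeixner.IsOrthogonalityMeasure.integral_sub_sq {θ τ s t x : ℝ} {μ : Measure ℝ}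
    (hμ : IsOrthogonalityMeasure (Q 0 θ τ s t x) μ) : ∫ y, (y - x) ^ 2 ∂μ = t - s := by
  have := hμ.isProbabilityMeasure
  have h1 := hμ.integral_Q_succ 0
  have h2 := hμ.integral_Q_succ 1
  have iμ := integrable_eval_of_integrable_pow hμ.integrable_pow
  have h : ∀ y : ℝ, (y - x) ^ 2 = (Q 0 θ τ s t x 2).eval y
      + (θ - x) * (Q 0 θ τ s t x 1).eval y + (t - s) := fun y => by
    simp only [Q_zero_two, Q_zero_one, Polynomial.eval_sub, Polynomial.eval_mul,
      Polynomial.eval_X, Polynomial.eval_C]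
    ring
  have hi : Integrable (fun y => (Q 0 θ τ s t x 2).eval y
      + (θ - x) * (Q 0 θ τ s t x 1).eval y) μ := (iμ _).add ((iμ _).const_mul _)
  simp only [h]
  rw [integral_add hi (integrable_const _), integral_add (iμ _) ((iμ _).const_mul _), integral_const_mul, h1, h2]
  simp

/-- Integrals against measures that concentrate at a point converge. -/
theorem tendsto_integral_of_concentrating {ι : Type*} {l : Filter ι} {μ : ι → Measure ℝ}
    {v : ι → ℝ} {v₀ x M : ℝ} {G : ℝ × ℝ → ℝ} (hG : Continuous G) (hv : Tendsto v l (𝓝 v₀))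
    (hprob : ∀ᶠ i in l, IsProbabilityMeasure (μ i))
    (hsupp : ∀ᶠ i in l, μ i (Icc (-M) M)ᶜ = 0)
    (hconc : Tendsto (fun i => ∫ y, (y - x) ^ 2 ∂(μ i)) l (𝓝 0)) :
    Tendsto (fun i => ∫ y, G (v i, y) ∂(μ i)) l (𝓝 (G (v₀, x))) := by
  obtain ⟨C, hC⟩ := ((isCompact_Icc (a := v₀ - 1) (b := v₀ + 1)).prod
    (isCompact_Icc (a := -M) (b := M))).exists_bound_of_continuousOn
      (f := fun q => G q - G (v₀, x)) (by fun_prop)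
  rw [Metric.tendsto_nhds]
  intro ε hε
  obtain ⟨δ, hδ, hGδ⟩ := Metric.continuous_iff.mp hG (v₀, x) (ε / 2) (half_pos hε)
  have hev : ∀ᶠ i in l, (|C| / δ ^ 2) * ∫ y, (y - x) ^ 2 ∂(μ i) < ε / 2 := by
    have h := hconc.const_mul (|C| / δ ^ 2)
    rw [mul_zero] at h
    exact h.eventually_lt_const (half_pos hε)
  filter_upwards [hprob, hsupp, hev, hv.eventually (Metric.ball_mem_nhds v₀ hδ),
    hv.eventually (Metric.ball_mem_nhds v₀ one_pos)] with i hi hs hlt hvδ hv1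
  rw [Real.dist_eq] at hvδ hv1
  have hcG : Continuous fun y => G (v i, y) := by fun_prop
  -- A pointwise Chebyshev estimate: continuity near `x`, and away from `x` the uniform bound `C`
  -- paid for by `(y - x) ^ 2 / δ ^ 2 ≥ 1`.
  have hpt : ∀ y ∈ Icc (-M) M,
      ‖G (v i, y) - G (v₀, x)‖ ≤ ε / 2 + (|C| / δ ^ 2) * (y - x) ^ 2 := fun y hy => by
    by_cases hyx : |y - x| < δ
    · have h := hGδ (v i, y) (by
        rw [Prod.dist_eq, Real.dist_eq, Real.dist_eq]
        exact max_lt hvδ hyx)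
      rw [dist_eq_norm] at h
      exact h.le.trans (le_add_of_nonneg_right (by positivity))
    · have h1 := hC (v i, y) ⟨by rw [abs_lt] at hv1; constructor <;> linarith, hy⟩
      have h2 : δ ^ 2 ≤ (y - x) ^ 2 := by
        rw [← sq_abs (y - x)]
        exact pow_le_pow_left₀ hδ.le (not_lt.mp hyx) 2
      have h3 : |C| ≤ (|C| / δ ^ 2) * (y - x) ^ 2 := by
        rw [div_mul_eq_mul_div, le_div_iff₀ (by positivity)]
        exact mul_le_mul_of_nonneg_left h2 (abs_nonneg C)
      linarith [le_abs_self C]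
  have hint : Integrable (fun y => ε / 2 + (|C| / δ ^ 2) * (y - x) ^ 2) (μ i) :=
    Continuous.integrable_of_measure_compl_Icc_eq_zero (by fun_prop) hs
  have hsq : Integrable (fun y => (|C| / δ ^ 2) * (y - x) ^ 2) (μ i) :=
    Continuous.integrable_of_measure_compl_Icc_eq_zero (by fun_prop) hs
  have hdiff : ∫ y, G (v i, y) ∂(μ i) - G (v₀, x) = ∫ y, (G (v i, y) - G (v₀, x)) ∂(μ i) := by
    rw [integral_sub (hcG.integrable_of_measure_compl_Icc_eq_zero hs) (integrable_const _)]
    simp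
  rw [dist_eq_norm, hdiff]
  refine (norm_integral_le_of_norm_le hint ?_).trans_lt ?_
  · filter_upwards [ae_mem_of_measure_compl_eq_zero hs] with y hy using hpt y hy
  · rw [integral_add (integrable_const _) hsq, integral_const_mul]
    simp only [integral_const, probReal_univ, one_smul]
    linarith

/-- Supplies one compact interval for all short time steps, as the concentration argument needs. -/
theorem supportBound_le {θ τ s t x T : ℝ} (hs : t - s ≤ 1) (ht : t + τ ≤ T) :
    supportBound θ τ s t x ≤ |θ| + 4 * √T + |x - θ| + 2 := by
  have h1 : √(t + τ) ≤ √T := Real.sqrt_le_sqrt ht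
  have h2 : √(t - s) ≤ 1 := Real.sqrt_le_one.mpr hs
  have h3 : |√(t - s) - √(t + τ)| ≤ 1 + √T := by
    rw [abs_le]
    constructor <;> linarith [Real.sqrt_nonneg (t - s), Real.sqrt_nonneg (t + τ)]
  unfold supportBound
  linarith

/-! ### Quotients, their limits and bounds -/

section Generators

variable {θ τ t : ℝ} {f f' f'' : ℝ → ℝ}

theorem quotient_eq_integral_semicircleMean {s x : ℝ} (hst : s < t) (htτ : 0 < t + τ)
    (hf : ∀ u, HasDerivAt f (f' u) u) (hf' : ∀ u, HasDerivAt f' (f'' u) u)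
    (hf'' : Continuous f'') :
    1 / (t - s) * (transitionOp 0 θ τ s t f x - f x)
      = ∫ y, semicircleMean θ (fun q => secondDiff f'' x q.1 q.2) (t + τ, y)
          ∂(transition 0 θ τ s t x) := by
  rw [transitionOp, integral_sub_eq_semicircleMean hst.le htτ
    (isOrthogonalityMeasure_transition θ τ s t x hst.le htτ.le) hf hf' hf'', ← mul_assoc,
    one_div_mul_cancel (sub_pos.mpr hst).ne', one_mul]

/-- The quotient averages second divided differences over two probability measures, so the bound
depends on neither `x` nor the time step. -/
theorem abs_quotient_le {s x C : ℝ} (hst : s < t) (htτ : 0 < t + τ)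
    (hf : ∀ u, HasDerivAt f (f' u) u) (hf' : ∀ u, HasDerivAt f' (f'' u) u)
    (hf'' : Continuous f'') (hC : ∀ u, |f'' u| ≤ C) :
    |1 / (t - s) * (transitionOp 0 θ τ s t f x - f x)| ≤ C := by
  have := (isOrthogonalityMeasure_transition θ τ s t x hst.le htτ.le).isProbabilityMeasure
  have := isProbabilityMeasure_semicircle θ htτ
  rw [quotient_eq_integral_semicircleMean hst htτ hf hf' hf'']
  have h (y : ℝ) : ‖semicircleMean θ (fun q => secondDiff f'' x q.1 q.2) (t + τ, y)‖ ≤ C := by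
    rw [← integral_semicircle_eq_semicircleMean θ htτ]
    simpa using norm_integral_le_of_norm_le_const (μ := semicircle θ (t + τ)) (C := C)
      (f := fun z => secondDiff f'' x y z) (ae_of_all _ fun z =>
        abs_secondDiff_le convex_univ (mem_univ x) (mem_univ y) (mem_univ z) fun u _ => hC u)
  simpa using norm_integral_le_of_norm_le_const (μ := transition 0 θ τ s t x) (ae_of_all _ h)

theorem ae_diffQuotDeriv_eq_secondDiff (x v : ℝ) (hf : ∀ u, HasDerivAt f (f' u) u)
    (hf' : ∀ u, HasDerivAt f' (f'' u) u) (hf'' : Continuous f'') :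
    (fun y => secondDiff f'' x x y) =ᵐ[semicircle θ v] diffQuotDeriv f x := by
  have := nullSingletonClass_semicircle θ v
  filter_upwards [ae_ne_of_nullSingletonClass (semicircle θ v) x] with y hy
  exact (diffQuotDeriv_eq_secondDiff hf hf' hf'' hy).symm

theorem integrableOn_diffQuotDeriv (x : ℝ) {v : ℝ} (hv : 0 < v)
    (hf : ∀ u, HasDerivAt f (f' u) u) (hf' : ∀ u, HasDerivAt f' (f'' u) u)
    (hf'' : Continuous f'') (K : Set ℝ) :
    IntegrableOn (diffQuotDeriv f x) K (semicircle θ v) := by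
  have := isProbabilityMeasure_semicircle θ hv
  have hc : Continuous fun y => secondDiff f'' x x y :=
    (continuous_secondDiff hf'' x).comp (Continuous.prodMk_right x)
  exact ((hc.integrable_of_measure_compl_Icc_eq_zero (semicircle_compl_Icc θ v hv)).congr
    (ae_diffQuotDeriv_eq_secondDiff x v hf hf' hf'')).integrableOn

theorem integral_diffQuotDeriv (x : ℝ) {v : ℝ} (hv : 0 < v)
    (hf : ∀ u, HasDerivAt f (f' u) u) (hf' : ∀ u, HasDerivAt f' (f'' u) u)
    (hf'' : Continuous f'') :
    ∫ y in Ioo (θ - 2 * √v) (θ + 2 * √v), diffQuotDeriv f x y ∂(semicircle θ v)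
      = semicircleMean θ (fun q => secondDiff f'' x q.1 q.2) (v, x) := by
  rw [Measure.restrict_eq_self_of_ae_mem
    (ae_mem_of_measure_compl_eq_zero (semicircle_compl_Ioo θ v hv)),
    ← integral_semicircle_eq_semicircleMean θ hv]
  exact integral_congr_ae (ae_diffQuotDeriv_eq_secondDiff x v hf hf' hf'').symm

/-- The quotients along time intervals `[s h, r h]` of length `h` ending near `t` converge. -/
theorem tendsto_quotient {s r : ℝ → ℝ} (htτ : 0 < t + τ) (hr : Tendsto r (𝓝[>] 0) (𝓝 t))
    (hsr : ∀ h, r h - s h = h) (x : ℝ)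
    (hf : ∀ u, HasDerivAt f (f' u) u) (hf' : ∀ u, HasDerivAt f' (f'' u) u)
    (hf'' : Continuous f'') :
    Tendsto (fun h => 1 / h * (transitionOp 0 θ τ (s h) (r h) f x - f x)) (𝓝[>] 0)
      (𝓝 (∫ y in Ioo (θ - 2 * √(t + τ)) (θ + 2 * √(t + τ)),
        diffQuotDeriv f x y ∂(semicircle θ (t + τ)))) := by
  rw [integral_diffQuotDeriv x htτ hf hf' hf'']
  have hv : Tendsto (fun h => r h + τ) (𝓝[>] 0) (𝓝 (t + τ)) := hr.add_const τ
  have hpos : ∀ᶠ h in 𝓝[>] (0 : ℝ), s h < r h ∧ 0 < r h + τ ∧ r h + τ ≤ t + τ + 1 ∧ h ≤ 1 := by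
    filter_upwards [self_mem_nhdsWithin, hv.eventually_const_lt htτ,
      hv.eventually_lt_const (lt_add_one (t + τ)),
      mem_nhdsWithin_of_mem_nhds (Iic_mem_nhds zero_lt_one)] with h h0 h1 h2 h3
    exact ⟨by linarith [hsr h, mem_Ioi.mp h0], h1, h2.le, h3⟩
  have horth : ∀ᶠ h in 𝓝[>] (0 : ℝ), IsOrthogonalityMeasure (Q 0 θ τ (s h) (r h) x)
      (transition 0 θ τ (s h) (r h) x) := by
    filter_upwards [hpos] with h hh
    exact isOrthogonalityMeasure_transition _ _ _ _ _ hh.1.le hh.2.1.le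
  refine (tendsto_integral_of_concentrating (M := |θ| + 4 * √(t + τ + 1) + |x - θ| + 2)
    (continuous_semicircleMean θ (continuous_secondDiff hf'' x)) hv
    (horth.mono fun h hh => hh.isProbabilityMeasure) ?_ ?_).congr' ?_
  · filter_upwards [horth, hpos] with h hh ⟨h1, h2, h3, h4⟩
    have hle := supportBound_le (θ := θ) (x := x) ((hsr h).trans_le h4) h3
    exact measure_mono_null (compl_subset_compl.mpr (Icc_subset_Icc (neg_le_neg hle) hle))
      (hh.measure_compl_Icc h1.le h2.le)
  · refine (tendsto_nhdsWithin_of_tendsto_nhds tendsto_id).congr' ?_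
    filter_upwards [horth] with h hh
    rw [hh.integral_sub_sq, hsr, id]
  · filter_upwards [hpos] with h ⟨h1, h2, _⟩
    have h' := quotient_eq_integral_semicircleMean (θ := θ) (x := x) h1 h2 hf hf' hf''
    rw [hsr] at h'
    exact h'.symm

theorem tendsto_leftQuotient (htτ : 0 < t + τ) (x : ℝ)
    (hf : ∀ u, HasDerivAt f (f' u) u) (hf' : ∀ u, HasDerivAt f' (f'' u) u)
    (hf'' : Continuous f'') :
    Tendsto (fun h => leftQuotient 0 θ τ t f h x) (𝓝[>] 0)
      (𝓝 (∫ y in Ioo (θ - 2 * √(t + τ)) (θ + 2 * √(t + τ)),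
        diffQuotDeriv f x y ∂(semicircle θ (t + τ)))) :=
  tendsto_quotient (s := fun h => t - h) (r := fun _ => t) htτ tendsto_const_nhds
    (fun h => by ring) x hf hf' hf''

theorem tendsto_rightQuotient (htτ : 0 < t + τ) (x : ℝ)
    (hf : ∀ u, HasDerivAt f (f' u) u) (hf' : ∀ u, HasDerivAt f' (f'' u) u)
    (hf'' : Continuous f'') :
    Tendsto (fun h => rightQuotient 0 θ τ t f h x) (𝓝[>] 0)
      (𝓝 (∫ y in Ioo (θ - 2 * √(t + τ)) (θ + 2 * √(t + τ)),
        diffQuotDeriv f x y ∂(semicircle θ (t + τ)))) := by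
  refine tendsto_quotient (s := fun _ => t) (r := fun h => t + h) htτ ?_
    (fun h => by ring) x hf hf' hf''
  have h : Tendsto (fun h : ℝ => t + h) (𝓝 0) (𝓝 (t + 0)) := by
    exact (continuous_const.add continuous_id).tendsto 0
  rw [add_zero] at h
  exact tendsto_nhdsWithin_of_tendsto_nhds h

theorem abs_leftQuotient_le {C h x : ℝ} (htτ : 0 < t + τ) (hh : 0 < h)
    (hf : ∀ u, HasDerivAt f (f' u) u) (hf' : ∀ u, HasDerivAt f' (f'' u) u)
    (hf'' : Continuous f'') (hC : ∀ u, |f'' u| ≤ C) : |leftQuotient 0 θ τ t f h x| ≤ C := by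
  have := abs_quotient_le (θ := θ) (x := x) (sub_lt_self t hh) htτ hf hf' hf'' hC
  rwa [sub_sub_cancel] at this

theorem abs_rightQuotient_le {C h x : ℝ} (htτ : 0 < t + τ) (hh : 0 < h)
    (hf : ∀ u, HasDerivAt f (f' u) u) (hf' : ∀ u, HasDerivAt f' (f'' u) u)
    (hf'' : Continuous f'') (hC : ∀ u, |f'' u| ≤ C) : |rightQuotient 0 θ τ t f h x| ≤ C := by
  have := abs_quotient_le (θ := θ) (τ := τ) (x := x) (lt_add_of_pos_right t hh) (by linarith)
    hf hf' hf'' hC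
  rwa [add_sub_cancel_left] at this

end Generators

theorem mainTheorem5 (θ τ : ℝ) (hτ : 0 ≤ τ) :
    -- the transition probabilities are well defined
    (∀ s t x : ℝ, 0 ≤ s → s < t →
      (∃! μ : Measure ℝ, IsOrthogonalityMeasure (Q 0 θ τ s t x) μ) ∧
        IsOrthogonalityMeasure (Q 0 θ τ s t x) (transition 0 θ τ s t x)) ∧
    ∀ t : ℝ, 0 < t →
      -- the semicircle law
      (IsProbabilityMeasure (semicircle θ (t + τ)) ∧
        semicircle θ (t + τ) (Ioo (θ - 2 * √(t + τ)) (θ + 2 * √(t + τ)))ᶜ = 0 ∧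
        Integrable (fun y : ℝ => y ^ 2) (semicircle θ (t + τ)) ∧
        ∫ y, y ∂(semicircle θ (t + τ)) = θ ∧
        ∫ y, (y - θ) ^ 2 ∂(semicircle θ (t + τ)) = t + τ) ∧
      -- polynomials
      (∀ (p : ℝ[X]) (x : ℝ),
        IntegrableOn (diffQuotDeriv (fun y => p.eval y) x)
          (Ioo (θ - 2 * √(t + τ)) (θ + 2 * √(t + τ))) (semicircle θ (t + τ)) ∧
        Tendsto (fun h => leftQuotient 0 θ τ t (fun y => p.eval y) h x) (𝓝[>] 0)
          (𝓝 (∫ y in Ioo (θ - 2 * √(t + τ)) (θ + 2 * √(t + τ)),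
            diffQuotDeriv (fun y => p.eval y) x y ∂(semicircle θ (t + τ)))) ∧
        Tendsto (fun h => rightQuotient 0 θ τ t (fun y => p.eval y) h x) (𝓝[>] 0)
          (𝓝 (∫ y in Ioo (θ - 2 * √(t + τ)) (θ + 2 * √(t + τ)),
            diffQuotDeriv (fun y => p.eval y) x y ∂(semicircle θ (t + τ))))) ∧
      -- bounded continuous functions with bounded continuous second derivative
      (∀ f : ℝ →ᵇ ℝ, ContDiff ℝ 2 f → (∃ C : ℝ, ∀ x, |iteratedDeriv 2 f x| ≤ C) →
        f ∈ weakLeftDomain 0 θ τ t ∩ weakRightDomain 0 θ τ t ∧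
        ∀ x : ℝ,
          IntegrableOn (diffQuotDeriv f x)
            (Ioo (θ - 2 * √(t + τ)) (θ + 2 * √(t + τ))) (semicircle θ (t + τ)) ∧
          weakLeftGenerator 0 θ τ t f x =
            ∫ y in Ioo (θ - 2 * √(t + τ)) (θ + 2 * √(t + τ)),
              diffQuotDeriv f x y ∂(semicircle θ (t + τ)) ∧
          weakRightGenerator 0 θ τ t f x =
            ∫ y in Ioo (θ - 2 * √(t + τ)) (θ + 2 * √(t + τ)),
              diffQuotDeriv f x y ∂(semicircle θ (t + τ))) := by
  refine ⟨fun s t x hs hst => ?_, fun t ht => ?_⟩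
  · have htτ : 0 ≤ t + τ := by linarith
    have h := isOrthogonalityMeasure_transition θ τ s t x hst.le htτ
    exact ⟨⟨_, h, fun μ hμ => hμ.unique hst.le htτ h⟩, h⟩
  have htτ : 0 < t + τ := by linarith
  refine ⟨⟨isProbabilityMeasure_semicircle θ htτ, semicircle_compl_Ioo θ _ htτ, ?_,
    integral_id_semicircle θ htτ, integral_sub_sq_semicircle θ htτ⟩, fun p x => ?_,
    fun f hf ⟨C, hC⟩ => ?_⟩
  · have := isProbabilityMeasure_semicircle θ htτ
    exact (continuous_pow 2).integrable_of_measure_compl_Icc_eq_zero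
      (semicircle_compl_Icc θ _ htτ)
  · have h1 := fun u => p.hasDerivAt u
    have h2 := fun u => p.derivative.hasDerivAt u
    have h3 := p.derivative.derivative.continuous
    exact ⟨integrableOn_diffQuotDeriv x htτ h1 h2 h3 _, tendsto_leftQuotient htτ x h1 h2 h3,
      tendsto_rightQuotient htτ x h1 h2 h3⟩
  · have hd : ContDiff ℝ 1 (deriv f) := hf.deriv'
    have h1 : ∀ u, HasDerivAt f (deriv f u) u := fun u =>
      (hf.differentiable (by norm_num)).differentiableAt.hasDerivAt
    have h2 : ∀ u, HasDerivAt (deriv f) (deriv (deriv f) u) u := fun u =>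
      (hd.differentiable (by norm_num)).differentiableAt.hasDerivAt
    have h3 : Continuous (deriv (deriv f)) := hd.continuous_deriv (by norm_num)
    have hC' : ∀ u, |deriv (deriv f) u| ≤ C := fun u => by
      simpa [iteratedDeriv_succ, iteratedDeriv_zero] using hC u
    have hl := fun x => tendsto_leftQuotient (θ := θ) htτ x h1 h2 h3
    have hr := fun x => tendsto_rightQuotient (θ := θ) htτ x h1 h2 h3
    refine ⟨⟨⟨fun x => ⟨_, hl x⟩, C, fun h hh x => abs_leftQuotient_le htτ hh.1 h1 h2 h3 hC'⟩,
      ⟨fun x => ⟨_, hr x⟩, C, fun h hh x => abs_rightQuotient_le htτ hh h1 h2 h3 hC'⟩⟩,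
      fun x => ⟨integrableOn_diffQuotDeriv x htτ h1 h2 h3 _, (hl x).limUnder_eq,
        (hr x).limUnder_eq⟩⟩
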